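/- Let $H(\mathbb C)$ be the algebra of entire functions with the topology of uniform convergence on compact sets. Let $\phi$ be a nonconstant entire function of exponential type, that is, $|\phi(z)|\le A e^{B|z|}$ for all $z\in\mathbb C$, for some constants $A,B$. Let $\phi(D)$ be the continuous linear operator on $H(\mathbb C)$ defined by $\phi(D)f=\sum_{n\ge 0}\frac{\phi^{(n)}(0)}{n!}f^{(n)}$. A function $f\in H(\mathbb C)$ is called hypercyclic for $\phi(D)$ if $\{\phi(D)^n f:\ n\ge 0\}$ is dense in $H(\mathbb C)$, and supercyclic for $\phi(D)$ if $\{\lambda\,\phi(D)^n f:\ \lambda\in\mathbb C,\ n\ge 0\}$ is dense in $H(\mathbb C)$. Then the following assertions are equivalent: (i) $\phi(D)$ supports a supercyclic algebra, that is, there is a nonzero (not necessarily unital) subalgebra of $H(\mathbb C)$ all of whose nonzero elements are supercyclic for $\phi(D)$. (ii) There exists $f\in H(\mathbb C)$ such that, for all $m\ge 1$, $f^m$ is hypercyclic for $\phi(D)$. (iii) $\phi$ is not a multiple of an exponential function, that is, there are no $c,a\in\mathbb C$ such that $\phi(z)=c\,e^{az}$ for all $z\in\mathbb C$. -/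

import Mathlib

open Complex Metric Topology Filter

/-! ### Linear dynamics: hypercyclic and supercyclic vectors, supercyclic algebras -/

/-- `x` is a hypercyclic vector for `T`: its orbit `{T ^ n x : n ≥ 0}` is dense. -/
def IsHypercyclicVector {X : Type*} [TopologicalSpace X] [AddCommGroup X] [Module ℂ X]
    (T : X →L[ℂ] X) (x : X) : Prop :=
  Dense {y : X | ∃ n : ℕ, y = (T ^ n) x}

/-- `x` is a supercyclic vector for `T`: its projective orbit
`{c • T ^ n x : c ∈ ℂ, n ≥ 0}` is dense. -/
def IsSupercyclicVector {X : Type*} [TopologicalSpace X] [AddCommGroup X] [Module ℂ X]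
    (T : X →L[ℂ] X) (x : X) : Prop :=
  Dense {y : X | ∃ (c : ℂ) (n : ℕ), y = c • (T ^ n) x}

/-- `T` supports a supercyclic algebra: there is a nonzero (not necessarily unital) subalgebra
of `X` all of whose nonzero elements are supercyclic vectors for `T`. -/
def SupportsSupercyclicAlgebra {X : Type*} [TopologicalSpace X] [Ring X] [Algebra ℂ X]
    (T : X →L[ℂ] X) : Prop :=
  ∃ A : NonUnitalSubalgebra ℂ X, A ≠ ⊥ ∧ ∀ x ∈ A, x ≠ 0 → IsSupercyclicVector T x

/-! ### The algebra `H(ℂ)` of entire functions -/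

/-- The entire functions, as a subalgebra of the continuous functions `C(ℂ, ℂ)`. -/
noncomputable def entireSubalgebra : Subalgebra ℂ C(ℂ, ℂ) where
  carrier := {f | Differentiable ℂ f}
  mul_mem' {f g} hf hg := by
    simpa using Differentiable.mul (show Differentiable ℂ f from hf) hg
  add_mem' {f g} hf hg := by
    simpa using Differentiable.add (show Differentiable ℂ f from hf) hg
  algebraMap_mem' c := by
    exact differentiable_const c

/-- The algebra `H(ℂ)` of entire functions with pointwise operations. Its topology is the
compact-open topology induced from `C(ℂ, ℂ)`, that is, uniform convergence on compact sets. -/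
abbrev EntireFunction : Type := entireSubalgebra

/-- The function underlying an element of `H(ℂ)`. -/
noncomputable def EntireFunction.toFun (f : EntireFunction) : ℂ → ℂ := f.1

theorem EntireFunction.differentiable (f : EntireFunction) : Differentiable ℂ f.toFun := f.2

/-! ### Functions of exponential type -/

/-- `φ` is of exponential type: `|φ z| ≤ A exp (B |z|)` for some constants `A`, `B`. -/
def IsExponentialType (φ : ℂ → ℂ) : Prop :=
  ∃ A B : ℝ, ∀ z : ℂ, ‖φ z‖ ≤ A * Real.exp (B * ‖z‖)

/-- `φ` is a multiple of an exponential function: `φ z = c exp (a z)` for some `c`, `a`. -/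
def IsMultipleOfExponential (φ : ℂ → ℂ) : Prop :=
  ∃ c a : ℂ, ∀ z : ℂ, φ z = c * Complex.exp (a * z)

/-- The `n`-th Taylor coefficient of `φ` at `0`. -/
noncomputable def taylorCoeffZero (φ : ℂ → ℂ) (n : ℕ) : ℂ :=
  iteratedDeriv n φ 0 / (n.factorial : ℂ)

/-- The Taylor coefficients of an entire function of exponential type decay like `ρ ^ n / n!`. -/
theorem norm_taylorCoeffZero_le {φ : ℂ → ℂ} (hφ : Differentiable ℂ φ) (hexp : IsExponentialType φ) :
    ∃ A ρ : ℝ, 0 ≤ A ∧ 0 < ρ ∧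
      ∀ n : ℕ, ‖taylorCoeffZero φ n‖ * n.factorial ≤ A * ρ ^ n := by
  obtain ⟨A, B, h⟩ := hexp
  have hA : 0 ≤ A := by
    have := (norm_nonneg _).trans (h 0)
    simpa using this
  refine ⟨A, Real.exp B, hA, Real.exp_pos B, fun n => ?_⟩
  have hfac : (0 : ℝ) < n.factorial := by exact_mod_cast n.factorial_pos
  rw [taylorCoeffZero, norm_div, Complex.norm_natCast, div_mul_cancel₀ _ hfac.ne']
  rcases Nat.eq_zero_or_pos n with rfl | hn
  · simpa using h 0
  have hn' : (0 : ℝ) < n := by exact_mod_cast hn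
  have hC : ∀ z ∈ sphere (0 : ℂ) (n : ℝ), ‖φ z‖ ≤ A * Real.exp B ^ n := by
    intro z hz
    have hz' : ‖z‖ = n := by simpa using hz
    have := h z
    rwa [hz', mul_comm B, Real.exp_nat_mul] at this
  have key := Complex.norm_iteratedDeriv_le_of_forall_mem_sphere_norm_le n hn'
    hφ.diffContOnCl hC
  refine key.trans ?_
  have h1 : (n.factorial : ℝ) ≤ (n : ℝ) ^ n := by exact_mod_cast n.factorial_le_pow
  rw [div_le_iff₀ (by positivity), mul_comm]
  exact mul_le_mul_of_nonneg_left h1 (by positivity)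

/-- Uniform estimate of the terms `φ⁽ⁿ⁾(0) / n! * f⁽ⁿ⁾(z)` on discs. -/
theorem norm_taylorCoeffZero_mul_iteratedDeriv_le {φ : ℂ → ℂ} (hφ : Differentiable ℂ φ)
    (hexp : IsExponentialType φ) :
    ∃ A r : ℝ, 0 ≤ A ∧ 0 < r ∧ ∀ (f : ℂ → ℂ), Differentiable ℂ f → ∀ R C : ℝ,
      (∀ z ∈ closedBall (0 : ℂ) (R + r), ‖f z‖ ≤ C) → ∀ n : ℕ, ∀ z ∈ closedBall (0 : ℂ) R,
        ‖taylorCoeffZero φ n * iteratedDeriv n f z‖ ≤ A * C * (1 / 2) ^ n := by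
  obtain ⟨A, ρ, hA, hρ, h⟩ := norm_taylorCoeffZero_le hφ hexp
  refine ⟨A, 2 * ρ, hA, by positivity, fun f hf R C hC n z hz => ?_⟩
  have hz' : ‖z‖ ≤ R := by simpa using hz
  have hC' : ∀ w ∈ sphere z (2 * ρ), ‖f w‖ ≤ C := by
    intro w hw
    apply hC
    have hw' : ‖w - z‖ = 2 * ρ := by simpa [dist_eq_norm] using hw
    have : ‖w‖ ≤ ‖z‖ + ‖w - z‖ := by
      simpa using norm_add_le z (w - z)
    simp only [mem_closedBall, dist_zero_right]
    linarith
  have hC0 : 0 ≤ C := by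
    refine (norm_nonneg _).trans (hC z ?_)
    simp only [mem_closedBall, dist_zero_right]
    linarith
  have key := Complex.norm_iteratedDeriv_le_of_forall_mem_sphere_norm_le n
    (show 0 < 2 * ρ by positivity) hf.diffContOnCl hC'
  rw [norm_mul]
  calc ‖taylorCoeffZero φ n‖ * ‖iteratedDeriv n f z‖
      ≤ ‖taylorCoeffZero φ n‖ * (n.factorial * C / (2 * ρ) ^ n) := by gcongr
    _ = (‖taylorCoeffZero φ n‖ * n.factorial) * (C / (2 * ρ) ^ n) := by ring
    _ ≤ (A * ρ ^ n) * (C / (2 * ρ) ^ n) := by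
        refine mul_le_mul_of_nonneg_right (h n) (by positivity)
    _ = A * C * (1 / 2) ^ n := by
        rw [mul_pow, one_div, inv_pow]
        field_simp

/-- An entire function is bounded on every disc. -/
theorem exists_bound_closedBall {f : ℂ → ℂ} (hf : Differentiable ℂ f) (R : ℝ) :
    ∃ C : ℝ, ∀ z ∈ closedBall (0 : ℂ) R, ‖f z‖ ≤ C :=
  (isCompact_closedBall (0 : ℂ) R).exists_bound_of_continuousOn hf.continuous.continuousOn

/-- The series defining `φ(D) f` converges absolutely at every point. -/
theorem summable_norm_taylorCoeffZero_mul_iteratedDeriv {φ : ℂ → ℂ} (hφ : Differentiable ℂ φ)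
    (hexp : IsExponentialType φ) {f : ℂ → ℂ} (hf : Differentiable ℂ f) (z : ℂ) :
    Summable fun n : ℕ => ‖taylorCoeffZero φ n * iteratedDeriv n f z‖ := by
  obtain ⟨A, r, -, -, h⟩ := norm_taylorCoeffZero_mul_iteratedDeriv_le hφ hexp
  obtain ⟨C, hC⟩ := exists_bound_closedBall hf (‖z‖ + r)
  exact Summable.of_nonneg_of_le (fun _ => norm_nonneg _)
    (fun n => h f hf ‖z‖ C hC n z (by simp)) (summable_geometric_two.mul_left _)

/-- The function `φ(D) f = ∑ₙ φ⁽ⁿ⁾(0) / n! * f⁽ⁿ⁾`. -/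
noncomputable def convolutionFun (φ f : ℂ → ℂ) (z : ℂ) : ℂ :=
  ∑' n : ℕ, taylorCoeffZero φ n * iteratedDeriv n f z

theorem hasSum_convolutionFun {φ : ℂ → ℂ} (hφ : Differentiable ℂ φ)
    (hexp : IsExponentialType φ) {f : ℂ → ℂ} (hf : Differentiable ℂ f) (z : ℂ) :
    HasSum (fun n : ℕ => taylorCoeffZero φ n * iteratedDeriv n f z) (convolutionFun φ f z) :=
  (summable_norm_taylorCoeffZero_mul_iteratedDeriv hφ hexp hf z).of_norm.hasSum

/-- If `φ` is of exponential type and `f` is entire then `φ(D) f` is entire. -/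
theorem differentiable_convolutionFun {φ : ℂ → ℂ} (hφ : Differentiable ℂ φ)
    (hexp : IsExponentialType φ) {f : ℂ → ℂ} (hf : Differentiable ℂ f) :
    Differentiable ℂ (convolutionFun φ f) := by
  obtain ⟨A, r, -, -, h⟩ := norm_taylorCoeffZero_mul_iteratedDeriv_le hφ hexp
  intro z
  obtain ⟨C, hC⟩ := exists_bound_closedBall hf (‖z‖ + 1 + r)
  have hd : DifferentiableOn ℂ (convolutionFun φ f) (ball 0 (‖z‖ + 1)) := by
    refine differentiableOn_tsum_of_summable_norm
      (u := fun n : ℕ => A * C * (1 / 2) ^ n) (summable_geometric_two.mul_left _)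
      (fun n => ?_) isOpen_ball (fun n w hw => h f hf _ C hC n w (ball_subset_closedBall hw))
    have hcd : ContDiff ℂ (n + 1 : ℕ) f := hf.contDiff
    exact ((hcd.differentiable_iteratedDeriv n (by exact_mod_cast n.lt_succ_self)).const_mul
      _).differentiableOn
  exact hd.differentiableAt (isOpen_ball.mem_nhds (by simp))

/-- `φ(D)` is bounded from the sup norm on a larger disc to the sup norm on a disc. -/
theorem norm_convolutionFun_le {φ : ℂ → ℂ} (hφ : Differentiable ℂ φ)
    (hexp : IsExponentialType φ) :
    ∃ A r : ℝ, 0 ≤ A ∧ ∀ (f : ℂ → ℂ), Differentiable ℂ f → ∀ R C : ℝ,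
      (∀ z ∈ closedBall (0 : ℂ) (R + r), ‖f z‖ ≤ C) → ∀ z ∈ closedBall (0 : ℂ) R,
        ‖convolutionFun φ f z‖ ≤ A * C := by
  obtain ⟨A, r, hA, -, h⟩ := norm_taylorCoeffZero_mul_iteratedDeriv_le hφ hexp
  refine ⟨A * 2, r, by positivity, fun f hf R C hC z hz => ?_⟩
  have hs : HasSum (fun n : ℕ => A * C * (1 / 2 : ℝ) ^ n) (A * C * 2) :=
    hasSum_geometric_two.mul_left _
  refine (tsum_of_norm_bounded hs fun n => h f hf R C hC n z hz).trans (le_of_eq ?_)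
  ring

theorem convolutionFun_add {φ : ℂ → ℂ} (hφ : Differentiable ℂ φ)
    (hexp : IsExponentialType φ) {f g : ℂ → ℂ} (hf : Differentiable ℂ f)
    (hg : Differentiable ℂ g) :
    convolutionFun φ (f + g) = convolutionFun φ f + convolutionFun φ g := by
  funext z
  refine HasSum.unique (hasSum_convolutionFun hφ hexp (hf.add hg) z) ?_
  rw [Pi.add_apply]
  convert (hasSum_convolutionFun hφ hexp hf z).add (hasSum_convolutionFun hφ hexp hg z) using 2
    with n
  rw [iteratedDeriv_add hf.contDiff.contDiffAt hg.contDiff.contDiffAt, mul_add]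

theorem convolutionFun_smul (φ : ℂ → ℂ) (c : ℂ) (f : ℂ → ℂ) :
    convolutionFun φ (c • f) = c • convolutionFun φ f := by
  funext z
  simp only [convolutionFun, Pi.smul_apply, smul_eq_mul, iteratedDeriv_const_smul_field]
  rw [← tsum_mul_left]
  exact tsum_congr fun n => by ring

/-- The convolution operator `φ(D) : H(ℂ) → H(ℂ)`, `φ(D) f = ∑ₙ φ⁽ⁿ⁾(0) / n! * f⁽ⁿ⁾`, for an
entire function `φ` of exponential type. -/
noncomputable def convolutionOperator (φ : ℂ → ℂ) (hφ : Differentiable ℂ φ)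
    (hexp : IsExponentialType φ) : EntireFunction →L[ℂ] EntireFunction where
  toFun f := ⟨⟨convolutionFun φ f.toFun,
    (differentiable_convolutionFun hφ hexp f.differentiable).continuous⟩,
    differentiable_convolutionFun hφ hexp f.differentiable⟩
  map_add' f g := by
    apply Subtype.ext
    apply ContinuousMap.ext
    exact congrFun (convolutionFun_add hφ hexp f.differentiable g.differentiable)
  map_smul' c f := by
    apply Subtype.ext
    apply ContinuousMap.ext
    exact congrFun (convolutionFun_smul φ c f.toFun)
  cont := by
    obtain ⟨A, r, hA, h⟩ := norm_convolutionFun_le hφ hexp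
    refine continuous_induced_rng.2 (continuous_iff_continuousAt.2 fun f => ?_)
    refine ContinuousMap.tendsto_iff_forall_isCompact_tendstoUniformlyOn.2 fun K hK => ?_
    obtain ⟨R, hR⟩ := hK.isBounded.subset_closedBall (0 : ℂ)
    have hid : Tendsto (fun g : EntireFunction => g.1) (𝓝 f) (𝓝 f.1) :=
      continuous_subtype_val.continuousAt
    have hu := ContinuousMap.tendsto_iff_forall_isCompact_tendstoUniformlyOn.1 hid _
      (isCompact_closedBall (0 : ℂ) (R + r))
    rw [Metric.tendstoUniformlyOn_iff] at hu ⊢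
    intro ε hε
    have hδ : 0 < ε / (A + 1) := by positivity
    filter_upwards [hu _ hδ] with g hg z hz
    have hsub : convolutionFun φ (f.toFun - g.toFun)
        = convolutionFun φ f.toFun - convolutionFun φ g.toFun := by
      have hs := convolutionFun_add hφ hexp (f.differentiable.sub g.differentiable)
        g.differentiable
      rw [sub_add_cancel] at hs
      rw [hs, add_sub_cancel_right]
    have hb := h (f.toFun - g.toFun) (f.differentiable.sub g.differentiable) R (ε / (A + 1))
      (fun w hw => by
        have := (hg w hw).le
        rwa [dist_eq_norm] at this) z (hR hz)
    rw [hsub] at hb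
    have hlt : A * (ε / (A + 1)) < ε := by
      rw [← mul_div_assoc, div_lt_iff₀ (by positivity)]
      nlinarith
    calc dist (convolutionFun φ f.toFun z) (convolutionFun φ g.toFun z)
        = ‖(convolutionFun φ f.toFun - convolutionFun φ g.toFun) z‖ := dist_eq_norm _ _
      _ ≤ A * (ε / (A + 1)) := hb
      _ < ε := hlt

/-!
Write `e_l` for the function `z ↦ exp (l z)` and `T = φ(D)`; then `T e_l = φ(l) e_l`, and
exponentials whose frequencies fill a segment span a dense subspace of `H(ℂ)`.

*Sufficiency.* The core is `exists_mem_forall_pow_apply_pow_mem`. Let `T` have the multiplier `Φ`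
on exponentials. Perturb a combination of exponentials with frequencies near `γ` by a sum of terms
`c q ^ N e_β` with `β` near `w / m` and `Φ(m β) q ^ m = 1`. After `N` iterations, the `n`-th power
is a sum over words of length `n`, each word being multiplied by the `N`-th power of a number,
namely `Φ` at the sum of the frequencies times the product of the `q`'s. The `m`-th powers of a
single perturbing term have multiplier `1` and give the target. A word with `k < m` perturbing
factors decays as soon as `r ^ k |Φ((n - k) γ + k w / m)| < 1`, where `|q| < r < 1`. The other
words of `m` perturbing factors decay if
`log |Φ|` is strictly convex along the segment carrying the frequencies `m β`. Now `log |Φ|` is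
harmonic near `w`, so it is strictly convex along some direction at every point where the
derivative of `Φ' / Φ` does not vanish, and such points exist near `w` precisely because `Φ` is
not a multiple of an exponential (`exists_segment_strictConvexOn`).

It remains to choose `γ` and `w`, and to apply Baire's theorem
(`exists_forall_pow_apply_pow_mem`).

* For hypercyclic powers, only `n = m` matters. By Liouville's theorem there are points with
  `|φ| < 1` and with `|φ| > 1`; on the segment joining them, a suitable `w` satisfies the
  inequalities with `m γ` the first endpoint (`exists_norm_apply_segment_lt_rpow`).
* For a supercyclic algebra, all `n ≤ m` matter, but `φ` may be multiplied by a constant depending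
  on `m`: with `γ = 0` and `w` a maximum point of `|φ|` on a disc, the maximum principle gives
  `|φ(k w / m)| < |φ(w)|` for `k < m` (`exists_norm_apply_smul_lt`), and the constant is chosen so
  that `1` lies in between. As `f ^ m` dominates the lower powers, all nonzero `P(f)` with
  `P(0) = 0` are supercyclic.

*Necessity.* If `φ(z) = c exp (a z)`, then `T` is `c` times a translation, so the projective orbit
of `f ^ 2` consists of multiples of squares; their zeros are multiple, and a Hurwitz type argument
(`not_forall_norm_mul_sq_sub_lt`) shows that they do not approximate the function `z`.
-/

/-! ### The space of entire functions -/

instance EntireFunction.instIsTopologicalRing : IsTopologicalRing EntireFunction :=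
  inferInstanceAs (IsTopologicalRing entireSubalgebra.toSubring)

instance EntireFunction.instSecondCountableTopology : SecondCountableTopology EntireFunction :=
  TopologicalSpace.Subtype.secondCountableTopology (entireSubalgebra : Set C(ℂ, ℂ))

theorem EntireFunction.tendsto_iff {ι : Type*} {l : Filter ι} {F : ι → EntireFunction}
    {f : EntireFunction} :
    Tendsto F l (𝓝 f) ↔
      ∀ R : ℝ, TendstoUniformlyOn (fun i => (F i).toFun) f.toFun l (closedBall 0 R) := by
  rw [nhds_subtype_eq_comap, tendsto_comap_iff,
    ContinuousMap.tendsto_iff_forall_isCompact_tendstoUniformlyOn]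
  refine ⟨fun h R => h _ (isCompact_closedBall 0 R), fun h K hK => ?_⟩
  obtain ⟨R, hR⟩ := hK.isBounded.subset_closedBall (0 : ℂ)
  exact (h R).mono hR

instance EntireFunction.instBaireSpace : BaireSpace EntireFunction := by
  have hclosed : IsClosed {f : C(ℂ, ℂ) | Differentiable ℂ f} := by
    refine isClosed_of_closure_subset fun f hf => ?_
    obtain ⟨u, hu, hlim⟩ := mem_closure_iff_seq_limit.1 hf
    have h := ContinuousMap.tendsto_iff_tendstoLocallyUniformly.1 hlim
    exact differentiableOn_univ.1 ((tendstoLocallyUniformlyOn_univ.2 h).differentiableOn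
      (Eventually.of_forall fun n => (hu n).differentiableOn) isOpen_univ)
  have : CompleteSpace {f : C(ℂ, ℂ) // Differentiable ℂ f} := hclosed.completeSpace_coe
  have : (uniformity {f : C(ℂ, ℂ) // Differentiable ℂ f}).IsCountablyGenerated :=
    inferInstanceAs (comap _ (uniformity C(ℂ, ℂ))).IsCountablyGenerated
  exact inferInstanceAs (BaireSpace {f : C(ℂ, ℂ) // Differentiable ℂ f})

/-- The exponential function `z ↦ exp (l z)` as an element of `H(ℂ)`. -/
noncomputable def expEntire (l : ℂ) : EntireFunction :=
  ⟨⟨fun z => cexp (l * z), by fun_prop⟩, show Differentiable ℂ fun z => cexp (l * z) by fun_prop⟩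

/-- The identity function as an element of `H(ℂ)`. -/
noncomputable def idEntire : EntireFunction :=
  ⟨⟨fun z => z, by fun_prop⟩, show Differentiable ℂ fun z : ℂ => z by fun_prop⟩

theorem EntireFunction.ext_toFun {f g : EntireFunction} (h : ∀ z, f.toFun z = g.toFun z) : f = g :=
  Subtype.ext (ContinuousMap.ext h)

@[simp] theorem toFun_expEntire (l z : ℂ) : (expEntire l).toFun z = cexp (l * z) := rfl

@[simp] theorem toFun_idEntire (z : ℂ) : idEntire.toFun z = z := rfl

@[simp] theorem EntireFunction.toFun_add (f g : EntireFunction) (z : ℂ) :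
    (f + g).toFun z = f.toFun z + g.toFun z := rfl

@[simp] theorem EntireFunction.toFun_sub (f g : EntireFunction) (z : ℂ) :
    (f - g).toFun z = f.toFun z - g.toFun z := rfl

@[simp] theorem EntireFunction.toFun_mul (f g : EntireFunction) (z : ℂ) :
    (f * g).toFun z = f.toFun z * g.toFun z := rfl

@[simp] theorem EntireFunction.toFun_smul (c : ℂ) (f : EntireFunction) (z : ℂ) :
    (c • f).toFun z = c * f.toFun z := rfl

@[simp] theorem EntireFunction.toFun_one (z : ℂ) : (1 : EntireFunction).toFun z = 1 := rfl

@[simp] theorem EntireFunction.toFun_zero (z : ℂ) : (0 : EntireFunction).toFun z = 0 := rfl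

@[simp] theorem EntireFunction.toFun_pow (f : EntireFunction) (n : ℕ) (z : ℂ) :
    (f ^ n).toFun z = f.toFun z ^ n := rfl

@[simp] theorem EntireFunction.toFun_sum {ι : Type*} (s : Finset ι) (F : ι → EntireFunction)
    (z : ℂ) : (∑ i ∈ s, F i).toFun z = ∑ i ∈ s, (F i).toFun z := by
  classical
  induction s using Finset.induction_on with
  | empty => simp
  | insert i s hi ih => rw [Finset.sum_insert hi, Finset.sum_insert hi, toFun_add, ih]

theorem expEntire_add (l k : ℂ) : expEntire (l + k) = expEntire l * expEntire k :=
  EntireFunction.ext_toFun fun z => by simp [add_mul, Complex.exp_add]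

theorem expEntire_zero : expEntire 0 = 1 := EntireFunction.ext_toFun fun z => by simp

theorem EntireFunction.eventually_norm_sub_lt (f : EntireFunction) (R : ℝ) {ε : ℝ} (hε : 0 < ε) :
    ∀ᶠ g in 𝓝 f, ∀ z ∈ closedBall (0 : ℂ) R, ‖g.toFun z - f.toFun z‖ < ε := by
  have h := EntireFunction.tendsto_iff.1 (tendsto_id (x := 𝓝 f)) R
  filter_upwards [Metric.tendstoUniformlyOn_iff.1 h ε hε] with g hg z hz
  have := hg z hz
  rwa [dist_comm, dist_eq_norm] at this

/-! ### Density of spans of exponentials -/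

/-- The derivative at `0` of `h ↦ exp (h d z)` is `d z`, in the topology of `H(ℂ)`. -/
theorem tendsto_inv_smul_expEntire_sub_one (d : ℂ) :
    Tendsto (fun h : ℝ => (h : ℂ)⁻¹ • (expEntire (h * d) - 1)) (𝓝[≠] 0) (𝓝 (d • idEntire)) := by
  refine EntireFunction.tendsto_iff.2 fun R => Metric.tendstoUniformlyOn_iff.2 fun ε hε => ?_
  set C : ℝ := ‖d‖ * |R| + 1 with hC
  have hC0 : 0 < C := by positivity
  have h1 : ∀ᶠ h : ℝ in 𝓝 0, |h| < min C⁻¹ (ε / C ^ 2) := by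
    have : Tendsto (fun h : ℝ => |h|) (𝓝 0) (𝓝 0) := by
      simpa using (continuous_abs.tendsto (0 : ℝ))
    exact this.eventually_lt_const (by positivity)
  filter_upwards [h1.filter_mono nhdsWithin_le_nhds, self_mem_nhdsWithin] with h hh h0 z hz
  have h0' : (h : ℂ) ≠ 0 := by exact_mod_cast h0
  have hz' : ‖z‖ ≤ |R| := (by simpa using hz : ‖z‖ ≤ R).trans (le_abs_self R)
  have hdz : ‖d * z‖ ≤ C := by
    rw [norm_mul]
    have := mul_le_mul_of_nonneg_left hz' (norm_nonneg d)
    linarith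
  have hx : ‖(h : ℂ) * d * z‖ ≤ |h| * C := by
    rw [mul_assoc, norm_mul, Complex.norm_real, Real.norm_eq_abs]
    gcongr
  have hx1 : ‖(h : ℂ) * d * z‖ ≤ 1 := by
    refine hx.trans ?_
    have := (lt_min_iff.1 hh).1.le
    calc |h| * C ≤ C⁻¹ * C := by gcongr
      _ = 1 := inv_mul_cancel₀ hC0.ne'
  have hb := Complex.norm_exp_sub_one_sub_id_le hx1
  rw [dist_comm, dist_eq_norm]
  have heq : ((h : ℂ)⁻¹ • (expEntire (h * d) - 1)).toFun z - (d • idEntire).toFun z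
      = (h : ℂ)⁻¹ * (cexp (h * d * z) - 1 - h * d * z) := by
    simp
    field_simp
  rw [heq, norm_mul, norm_inv, Complex.norm_real, Real.norm_eq_abs]
  have habs : 0 < |h| := abs_pos.2 h0
  calc |h|⁻¹ * ‖cexp (h * d * z) - 1 - h * d * z‖
      ≤ |h|⁻¹ * (|h| * C) ^ 2 := by
        gcongr
        exact hb.trans (by gcongr)
    _ = |h| * C ^ 2 := by field_simp
    _ < (ε / C ^ 2) * C ^ 2 := by
        gcongr
        exact (lt_min_iff.1 hh).2
    _ = ε := by field_simp

/-- Polynomials are dense in `H(ℂ)`, by Taylor expansion. -/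
theorem EntireFunction.mem_closure_span_pow (f : EntireFunction) :
    f ∈ (Submodule.span ℂ (Set.range fun n : ℕ => idEntire ^ n)).topologicalClosure := by
  have hp := f.differentiable.hasFPowerSeriesOnBall 0 (R := 1) one_pos
  set p := cauchyPowerSeries f.toFun 0 (1 : NNReal)
  have hlim : Tendsto (fun n : ℕ => ∑ k ∈ Finset.range n, p.coeff k • idEntire ^ k) atTop
      (𝓝 f) := by
    refine EntireFunction.tendsto_iff.2 fun R => ?_
    have h := hp.tendstoUniformlyOn (r' := Real.toNNReal (|R| + 1))
      ENNReal.coe_lt_top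
    simp only [zero_add] at h
    refine (h.mono fun z hz => ?_).congr (Eventually.of_forall fun n z hz => ?_)
    · have : ‖z‖ ≤ R := by simpa using hz
      have hlt := lt_of_le_of_lt (this.trans (le_abs_self R)) (lt_add_one _)
      simpa [Real.coe_toNNReal _ (by positivity : (0 : ℝ) ≤ |R| + 1)] using hlt
    · simp [FormalMultilinearSeries.partialSum, mul_comm]
  refine mem_closure_of_tendsto hlim (Eventually.of_forall fun n => ?_)
  exact Submodule.sum_mem _ fun k _ => Submodule.smul_mem _ _ (Submodule.subset_span ⟨k, rfl⟩)

/-- The exponentials `exp (l z)` with `l` in a segment span a dense subspace of `H(ℂ)`: its closure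
contains all derivatives `z ^ k exp (l z)` in the parameter, hence `exp (l z)` times any
polynomial. -/
theorem dense_span_expEntire_segment (l d : ℂ) (hd : d ≠ 0) {δ : ℝ} (hδ : 0 < δ) :
    Dense (Submodule.span ℂ ((fun s : ℝ => expEntire (l + s * d)) '' Set.Ioo (-δ) δ) :
      Set EntireFunction) := by
  set S := Submodule.span ℂ ((fun s : ℝ => expEntire (l + s * d)) '' Set.Ioo (-δ) δ)
  have hpow : ∀ k : ℕ, ∀ s ∈ Set.Ioo (-δ) δ,
      idEntire ^ k * expEntire (l + s * d) ∈ S.topologicalClosure := by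
    intro k
    induction k with
    | zero =>
      intro s hs
      rw [pow_zero, one_mul]
      exact S.le_topologicalClosure (Submodule.subset_span ⟨s, hs, rfl⟩)
    | succ k ih =>
      intro s hs
      have h1 := ((tendsto_inv_smul_expEntire_sub_one d).const_mul
        (idEntire ^ k * expEntire (l + s * d)))
      have h2 : idEntire ^ k * expEntire (l + s * d) * d • idEntire
          ∈ S.topologicalClosure := by
        refine S.isClosed_topologicalClosure.mem_of_tendsto h1 ?_
        have hnear : ∀ᶠ h : ℝ in 𝓝[≠] 0, s + h ∈ Set.Ioo (-δ) δ := by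
          refine Eventually.filter_mono nhdsWithin_le_nhds ?_
          have : Tendsto (fun h : ℝ => s + h) (𝓝 0) (𝓝 s) := by
            simpa using (continuous_const_add s).tendsto 0
          exact this.eventually (isOpen_Ioo.mem_nhds hs)
        filter_upwards [hnear] with h hh
        have heq : idEntire ^ k * expEntire (l + s * d) * ((h : ℂ)⁻¹ • (expEntire (h * d) - 1))
            = (h : ℂ)⁻¹ • (idEntire ^ k * expEntire (l + ((s + h : ℝ) : ℂ) * d))
              + (-(h : ℂ)⁻¹) • (idEntire ^ k * expEntire (l + s * d)) := by
          have : l + ((s + h : ℝ) : ℂ) * d = (l + s * d) + h * d := by push_cast; ring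
          rw [this, expEntire_add (l + s * d)]
          refine EntireFunction.ext_toFun fun z => ?_
          simp
          ring
        rw [heq]
        exact Submodule.add_mem _ (Submodule.smul_mem _ _ (ih _ hh))
          (Submodule.smul_mem _ _ (ih _ hs))
      have h3 := Submodule.smul_mem _ d⁻¹ h2
      rwa [mul_smul_comm, smul_smul, inv_mul_cancel₀ hd, one_smul, mul_right_comm,
        ← pow_succ] at h3
  intro f
  have hf := (f * expEntire (-l)).mem_closure_span_pow
  have hmap : ∀ g ∈ (Submodule.span ℂ (Set.range fun n : ℕ => idEntire ^ n)),
      g * expEntire l ∈ S.topologicalClosure := by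
    intro g hg
    induction hg using Submodule.span_induction with
    | mem x hx =>
      obtain ⟨k, rfl⟩ := hx
      simpa using hpow k 0 ⟨by linarith, hδ⟩
    | zero => simp
    | add x y _ _ hx hy => rw [add_mul]; exact Submodule.add_mem _ hx hy
    | smul c x _ hx => rw [smul_mul_assoc]; exact Submodule.smul_mem _ _ hx
  have hfin : f * expEntire (-l) * expEntire l ∈ closure (S.topologicalClosure : Set _) :=
    map_mem_closure (f := fun g => g * expEntire l) (by fun_prop) hf hmap
  rw [mul_assoc, ← expEntire_add, neg_add_cancel, expEntire_zero, mul_one] at hfin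
  rw [S.isClosed_topologicalClosure.closure_eq] at hfin
  exact hfin

theorem exists_sum_expEntire_mem (l d : ℂ) (hd : d ≠ 0) {δ : ℝ} (hδ : 0 < δ)
    {U : Set EntireFunction} (hU : IsOpen U) (hne : U.Nonempty) :
    ∃ (t : Finset ℝ) (c : t → ℂ), (∀ s : t, |(s : ℝ)| < δ) ∧
      ∑ s : t, c s • expEntire (l + (s : ℝ) * d) ∈ U := by
  obtain ⟨g, hgU, hg⟩ := (dense_span_expEntire_segment l d hd hδ).exists_mem_open hU hne
  obtain ⟨t, ht, c, rfl⟩ := (Submodule.mem_span_image_iff_exists_fun ℂ).1 hgU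
  exact ⟨t, c, fun s => abs_lt.2 (ht s.2), hg⟩

theorem convolutionOperator_expEntire (φ : ℂ → ℂ) (hφ : Differentiable ℂ φ)
    (hexp : IsExponentialType φ) (l : ℂ) :
    convolutionOperator φ hφ hexp (expEntire l) = φ l • expEntire l := by
  refine EntireFunction.ext_toFun fun z => ?_
  have h1 := hasSum_convolutionFun hφ hexp (expEntire l).differentiable z
  have h2 := (Complex.hasSum_taylorSeries_of_entire hφ 0 l).mul_right (cexp (l * z))
  have hfun : (expEntire l).toFun = fun s => cexp (l * s) := rfl
  refine h1.unique ?_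
  rw [hfun]
  have h3 : (fun n : ℕ => taylorCoeffZero φ n * iteratedDeriv n (fun s => cexp (l * s)) z)
      = fun n : ℕ => ((n.factorial : ℂ)⁻¹ • (l - 0) ^ n • iteratedDeriv n φ 0) * cexp (l * z) := by
    funext n
    rw [iteratedDeriv_cexp_const_mul, taylorCoeffZero]
    simp only [sub_zero, smul_eq_mul]
    ring
  rw [h3]
  exact h2

/-! ### Orbits of powers of exponential sums -/

section Orbits

variable {T : EntireFunction →L[ℂ] EntireFunction} {Φ : ℂ → ℂ}

theorem pow_apply_expEntire (hT : ∀ l, T (expEntire l) = Φ l • expEntire l) (l : ℂ) (N : ℕ) :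
    (T ^ N) (expEntire l) = Φ l ^ N • expEntire l := by
  induction N with
  | zero => simp
  | succ N ih =>
    rw [pow_succ, mul_apply_eq_comp, hT, map_smul, ih, smul_smul, pow_succ']

/-- The orbit of the `n`-th power of an exponential sum with coefficients `c x * q x ^ N`, at the
time `N`: after expanding the power, each term is multiplied by the `N`-th power of a number which
does not depend on `N`. -/
theorem pow_apply_sum_expEntire_pow (hT : ∀ l, T (expEntire l) = Φ l • expEntire l)
    {X : Type*} [Fintype X] (c q f : X → ℂ) (n N : ℕ) :
    (T ^ N) ((∑ x, (c x * q x ^ N) • expEntire (f x)) ^ n)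
      = ∑ p : Fin n → X, ((∏ i, c (p i)) * (Φ (∑ i, f (p i)) * ∏ i, q (p i)) ^ N) •
          expEntire (∑ i, f (p i)) := by
  have hexpand : (∑ x, (c x * q x ^ N) • expEntire (f x)) ^ n
      = ∑ p : Fin n → X, (∏ i, (c (p i) * q (p i) ^ N)) • expEntire (∑ i, f (p i)) := by
    refine EntireFunction.ext_toFun fun z => ?_
    rw [EntireFunction.toFun_pow, EntireFunction.toFun_sum, Fintype.sum_pow,
      EntireFunction.toFun_sum]
    simp only [EntireFunction.toFun_smul, toFun_expEntire, Finset.prod_mul_distrib,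
      Finset.sum_mul, Complex.exp_sum]
  rw [hexpand, map_sum]
  refine Finset.sum_congr rfl fun p _ => ?_
  rw [map_smul, pow_apply_expEntire hT, smul_smul, Finset.prod_mul_distrib, Finset.prod_pow,
    mul_pow]
  congr 1
  ring

/-- If every term of the expansion decays, except those `m`-th powers of a single exponential
`exp (f (inr j) z)` whose multiplier is `1`, then the orbits of the powers converge. -/
theorem tendsto_pow_apply_sum_expEntire_pow (hT : ∀ l, T (expEntire l) = Φ l • expEntire l)
    {I J : Type*} [Fintype I] [Fintype J] (c q f : I ⊕ J → ℂ) {m : ℕ} (hm : m ≠ 0) {n : ℕ}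
    (hlt : ∀ p : Fin n → I ⊕ J, ¬ (n = m ∧ ∃ j, ∀ i, p i = Sum.inr j) →
      ‖Φ (∑ i, f (p i)) * ∏ i, q (p i)‖ < 1)
    (hone : ∀ j, Φ (m * f (Sum.inr j)) * q (Sum.inr j) ^ m = 1) :
    Tendsto (fun N : ℕ => (T ^ N) ((∑ x, (c x * q x ^ N) • expEntire (f x)) ^ n)) atTop
      (𝓝 (if n = m then ∑ j, c (Sum.inr j) ^ m • expEntire (m * f (Sum.inr j)) else 0)) := by
  classical
  set g : (Fin n → I ⊕ J) → EntireFunction := fun p =>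
    if n = m ∧ ∃ j, ∀ i, p i = Sum.inr j then
      (∏ i, c (p i)) • expEntire (∑ i, f (p i)) else 0
  have hsum : (if n = m then ∑ j, c (Sum.inr j) ^ m • expEntire (m * f (Sum.inr j)) else 0)
      = ∑ p, g p := by
    split_ifs with hn
    · subst hn
      have : NeZero n := ⟨hm⟩
      refine Fintype.sum_of_injective (fun j _ => Sum.inr j) (fun j j' h => ?_) _ _
        (fun p hp => ?_) (fun j => ?_)
      · exact Sum.inr_injective (congrFun h 0)
      · refine if_neg fun h => hp ?_
        obtain ⟨-, j, hj⟩ := h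
        exact ⟨j, funext fun i => (hj i).symm⟩
      · have hg : g (fun _ => Sum.inr j)
            = (∏ _i : Fin n, c (Sum.inr j)) • expEntire (∑ _i : Fin n, f (Sum.inr j)) :=
          if_pos ⟨rfl, j, fun _ => rfl⟩
        rw [hg]
        simp
    · exact (Finset.sum_eq_zero fun p _ => if_neg fun h => hn h.1).symm
  rw [hsum]
  simp only [pow_apply_sum_expEntire_pow hT]
  refine tendsto_finsetSum _ fun p _ => ?_
  by_cases h : n = m ∧ ∃ j, ∀ i, p i = Sum.inr j
  · have hg : g p = (∏ i, c (p i)) • expEntire (∑ i, f (p i)) := if_pos h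
    obtain ⟨rfl, j, hj⟩ := h
    rw [hg]
    refine tendsto_const_nhds.congr fun N => ?_
    have : Φ (∑ i, f (p i)) * ∏ i, q (p i) = 1 := by simpa [hj] using hone j
    rw [this, one_pow, mul_one]
  · have hg : g p = 0 := if_neg h
    rw [hg]
    have h0 := (tendsto_pow_atTop_nhds_zero_of_norm_lt_one (hlt p h)).const_mul (∏ i, c (p i))
    simpa using h0.smul_const (expEntire (∑ i, f (p i)))

end Orbits

/-! ### Strict convexity of `log |Φ|` along a segment -/

theorem exists_mul_exp_of_eventually_deriv_logDeriv_eq_zero {Φ : ℂ → ℂ} (hΦ : Differentiable ℂ Φ)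
    {w : ℂ} (hw : Φ w ≠ 0) (h : ∀ᶠ z in 𝓝 w, deriv (logDeriv Φ) z = 0) :
    IsMultipleOfExponential Φ := by
  have hne : ∀ᶠ z in 𝓝 w, Φ z ≠ 0 := hΦ.continuous.continuousAt.eventually_ne hw
  obtain ⟨ε, hε, hball⟩ := Metric.eventually_nhds_iff_ball.1 (h.and hne)
  have hd : Differentiable ℂ (deriv Φ) := fun z => (hΦ.analyticAt z).deriv.differentiableAt
  have hlog : ∀ z ∈ ball w ε, logDeriv Φ z = logDeriv Φ w := by
    intro z hz
    refine isOpen_ball.is_const_of_deriv_eq_zero (convex_ball w ε).isPreconnected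
      (fun y hy => ?_) (fun y hy => (hball y hy).1) hz (mem_ball_self hε)
    exact ((hd y).div (hΦ y) (hball y hy).2).differentiableWithinAt
  set a := logDeriv Φ w
  set G : ℂ → ℂ := fun z => Φ z * cexp (-a * z)
  have hG : ∀ z, HasDerivAt G ((deriv Φ z - a * Φ z) * cexp (-a * z)) z := by
    intro z
    have h1 : HasDerivAt (fun z => cexp (-a * z)) (cexp (-a * z) * (-a * 1)) z :=
      ((hasDerivAt_id z).const_mul (-a)).cexp
    exact ((hΦ z).hasDerivAt.mul h1).congr_deriv (by ring)
  have hGd : Differentiable ℂ G := fun z => (hG z).differentiableAt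
  have hconst : ∀ z ∈ ball w ε, G z = G w := by
    intro z hz
    refine isOpen_ball.is_const_of_deriv_eq_zero (convex_ball w ε).isPreconnected
      hGd.differentiableOn (fun y hy => ?_) hz (mem_ball_self hε)
    have hy2 := hlog y hy
    rw [logDeriv_apply, div_eq_iff (hball y hy).2] at hy2
    simp [(hG y).deriv, hy2]
  have hev : G =ᶠ[𝓝 w] fun _ => G w := by
    filter_upwards [ball_mem_nhds w hε] with z hz using hconst z hz
  have hall := AnalyticOnNhd.eq_of_eventuallyEq (𝕜 := ℂ) (fun z _ => hGd.analyticAt z)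
    (fun z _ => analyticAt_const) hev
  refine ⟨G w, a, fun z => ?_⟩
  have := congrFun hall z
  simp only [G] at this ⊢
  rw [← this, mul_assoc, ← Complex.exp_add]
  simp

theorem hasDerivAt_log_norm_comp_line {Φ : ℂ → ℂ} (hΦ : Differentiable ℂ Φ) (w d : ℂ) (s : ℝ)
    (h : Φ (w + s * d) ≠ 0) :
    HasDerivAt (fun t : ℝ => Real.log ‖Φ (w + t * d)‖) (d * logDeriv Φ (w + s * d)).re s := by
  have hline : HasDerivAt (fun t : ℝ => w + t * d) d s := by
    simpa using ((hasDerivAt_id s).ofReal_comp.mul_const d).const_add w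
  have hF : HasDerivAt (fun t : ℝ => Φ (w + t * d)) (deriv Φ (w + s * d) * d) s :=
    (hΦ _).hasDerivAt.comp s hline
  have hsq := (hF.norm_sq.log (by positivity)).const_mul (1 / 2 : ℝ)
  have hfun : (fun t : ℝ => 1 / 2 * Real.log (‖Φ (w + t * d)‖ ^ 2))
      = fun t : ℝ => Real.log ‖Φ (w + t * d)‖ := by
    funext t
    rw [Real.log_pow]
    push_cast
    ring
  rw [hfun] at hsq
  refine hsq.congr_deriv ?_
  have hn : (‖Φ (w + s * d)‖ : ℝ) ≠ 0 := norm_ne_zero_iff.2 h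
  have hinner : (deriv Φ (w + s * d) * d) * (starRingEnd ℂ) (Φ (w + s * d))
      = ((‖Φ (w + s * d)‖ ^ 2 : ℝ) : ℂ) * (d * logDeriv Φ (w + s * d)) := by
    rw [logDeriv_apply, ← normSq_eq_norm_sq, ← Complex.mul_conj]
    field_simp
  rw [Complex.inner, hinner, Complex.re_ofReal_mul]
  field_simp

theorem exists_strictConvexOn_log_norm {Φ : ℂ → ℂ} (hΦ : Differentiable ℂ Φ) {w : ℂ}
    (hw : Φ w ≠ 0) (h2 : deriv (logDeriv Φ) w ≠ 0) :
    ∃ d : ℂ, ‖d‖ = 1 ∧ ∃ δ > 0,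
      StrictConvexOn ℝ (Set.Ioo (-δ) δ) fun t : ℝ => Real.log ‖Φ (w + t * d)‖ := by
  set L := logDeriv Φ
  obtain ⟨d, hd⟩ := IsAlgClosed.exists_pow_nat_eq
    ((starRingEnd ℂ) (deriv L w) / (‖deriv L w‖ : ℂ)) (n := 2) two_pos
  have hnorm0 : ‖deriv L w‖ ≠ 0 := norm_ne_zero_iff.2 h2
  have hd1 : ‖d‖ = 1 := by
    have : ‖d‖ ^ 2 = 1 := by
      rw [← norm_pow, hd, norm_div, RCLike.norm_conj, Complex.norm_real, norm_norm,
        div_self hnorm0]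
    nlinarith [norm_nonneg d]
  have hpos : 0 < (d ^ 2 * deriv L w).re := by
    have : d ^ 2 * deriv L w = (‖deriv L w‖ : ℝ) := by
      have h0 : (‖deriv L w‖ : ℂ) ≠ 0 := by exact_mod_cast hnorm0
      rw [hd, div_mul_eq_mul_div, mul_comm, Complex.mul_conj, normSq_eq_norm_sq]
      push_cast
      field_simp
    rw [this, Complex.ofReal_re]
    positivity
  have hd' : Differentiable ℂ (deriv Φ) := fun z => (hΦ.analyticAt z).deriv.differentiableAt
  have hLan : ∀ z, Φ z ≠ 0 → AnalyticAt ℂ L z := fun z hz =>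
    (hΦ.analyticAt z).deriv.div (hΦ.analyticAt z) hz
  have hcont : ContinuousAt (fun s : ℝ => (d ^ 2 * deriv L (w + s * d)).re) 0 := by
    have h1 : ContinuousAt (deriv L) (w + (0 : ℝ) * d) := by
      simpa using (hLan w hw).deriv.continuousAt
    have h3 : ContinuousAt (fun s : ℝ => deriv L (w + s * d)) 0 :=
      ContinuousAt.comp (g := deriv L) (f := fun s : ℝ => w + s * d) h1 (by fun_prop)
    exact Complex.continuous_re.continuousAt.comp (continuousAt_const.mul h3)
  have hev1 : ∀ᶠ s : ℝ in 𝓝 0, 0 < (d ^ 2 * deriv L (w + s * d)).re :=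
    hcont.eventually (lt_mem_nhds (by simpa using hpos))
  have hev2 : ∀ᶠ s : ℝ in 𝓝 0, Φ (w + s * d) ≠ 0 := by
    have hc : Continuous fun s : ℝ => Φ (w + s * d) := hΦ.continuous.comp (by fun_prop)
    exact hc.continuousAt.eventually_ne (by simpa using hw)
  obtain ⟨δ, hδ, hball⟩ := Metric.eventually_nhds_iff_ball.1 (hev1.and hev2)
  rw [Real.ball_eq_Ioo, zero_sub, zero_add] at hball
  refine ⟨d, hd1, δ, hδ, strictConvexOn_of_deriv2_pos (convex_Ioo _ _) (fun s hs => ?_)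
    fun s hs => ?_⟩
  · exact (hasDerivAt_log_norm_comp_line hΦ w d s
      (hball s hs).2).continuousAt.continuousWithinAt
  · rw [interior_Ioo] at hs
    have hderiv : deriv (fun t : ℝ => Real.log ‖Φ (w + t * d)‖)
        =ᶠ[𝓝 s] fun t : ℝ => (d * L (w + t * d)).re := by
      filter_upwards [isOpen_Ioo.mem_nhds hs] with t ht
      exact (hasDerivAt_log_norm_comp_line hΦ w d t (hball t ht).2).deriv
    have hline : HasDerivAt (fun t : ℝ => w + t * d) d s := by
      simpa using ((hasDerivAt_id s).ofReal_comp.mul_const d).const_add w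
    have hLd : HasDerivAt (fun t : ℝ => L (w + t * d)) (deriv L (w + s * d) * d) s :=
      (hLan _ (hball s hs).2).differentiableAt.hasDerivAt.comp s hline
    have hre : HasDerivAt (fun t : ℝ => (d * L (w + t * d)).re)
        (d * (deriv L (w + s * d) * d)).re s :=
      Complex.reCLM.hasFDerivAt.comp_hasDerivAt s (hLd.const_mul d)
    rw [Function.iterate_succ, Function.iterate_one, Function.comp_apply, hderiv.deriv_eq,
      hre.deriv]
    have := (hball s hs).1
    rwa [show d * (deriv L (w + s * d) * d) = d ^ 2 * deriv L (w + s * d) by ring]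

/-! ### Hitting open sets with powers of exponential sums -/

/-- The strict inequalities at `w` persist nearby, so `w` can be moved to a point through which
`log |Φ|` is strictly convex along a segment. -/
theorem exists_segment_strictConvexOn {Φ : ℂ → ℂ} (hΦ : Differentiable ℂ Φ)
    (hne : ¬ IsMultipleOfExponential Φ) {m : ℕ} {S : Finset ℕ} {γ w : ℂ} {r : ℝ}
    (hw : 1 < r ^ m * ‖Φ w‖)
    (hlow : ∀ n ∈ S, ∀ k ≤ n, k < m → r ^ k * ‖Φ ((n - k) * γ + k * (w / m))‖ < 1) :
    ∃ (w' d : ℂ) (δ : ℝ), ‖d‖ = 1 ∧ 0 < δ ∧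
      (∀ η : ℂ, ‖η‖ < δ → 1 < r ^ m * ‖Φ (w' + η)‖) ∧
      (∀ n ∈ S, ∀ k ≤ n, k < m → ∀ η : ℂ, ‖η‖ < δ →
        r ^ k * ‖Φ ((n - k) * γ + k * (w' / m) + η)‖ < 1) ∧
      StrictConvexOn ℝ (Set.Ioo (-δ) δ) fun t : ℝ => Real.log ‖Φ (w' + t * d)‖ := by
  have hc := hΦ.continuous
  have hw0 : Φ w ≠ 0 := by
    rintro h
    simp [h] at hw
    linarith
  have hev1 : ∀ᶠ z in 𝓝 w, 1 < r ^ m * ‖Φ z‖ :=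
    (show Continuous fun z => r ^ m * ‖Φ z‖ by fun_prop).continuousAt.eventually (lt_mem_nhds hw)
  have hev2 : ∀ᶠ z in 𝓝 w, ∀ n ∈ S, ∀ k ∈ Finset.range m, k ≤ n →
      r ^ k * ‖Φ ((n - k) * γ + k * (z / m))‖ < 1 := by
    refine (Filter.eventually_all_finset S).2 fun n hn =>
      (Filter.eventually_all_finset _).2 fun k hk => ?_
    by_cases hkn : k ≤ n
    · filter_upwards [(show Continuous fun z : ℂ => r ^ k * ‖Φ ((n - k) * γ + k * (z / m))‖ by
        fun_prop).continuousAt.eventually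
        (gt_mem_nhds (hlow n hn k hkn (Finset.mem_range.1 hk)))] with z hz _ using hz
    · exact Eventually.of_forall fun z h => absurd h hkn
  have hev0 : ∀ᶠ z in 𝓝 w, Φ z ≠ 0 := hc.continuousAt.eventually_ne hw0
  have hfreq : ∃ᶠ z in 𝓝 w, deriv (logDeriv Φ) z ≠ 0 := fun h =>
    hne (exists_mul_exp_of_eventually_deriv_logDeriv_eq_zero hΦ hw0 (by simpa using h))
  obtain ⟨w', hL, h1, h2, h0⟩ := (hfreq.and_eventually (hev1.and (hev2.and hev0))).exists
  obtain ⟨d, hd, δ₀, hδ₀, hconv⟩ := exists_strictConvexOn_log_norm hΦ h0 hL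
  have hev3 : ∀ᶠ η in 𝓝 (0 : ℂ), 1 < r ^ m * ‖Φ (w' + η)‖ :=
    (show Continuous fun η => r ^ m * ‖Φ (w' + η)‖ by fun_prop).continuousAt.eventually
      (lt_mem_nhds (by simpa using h1))
  have hev4 : ∀ᶠ η in 𝓝 (0 : ℂ), ∀ n ∈ S, ∀ k ∈ Finset.range m, k ≤ n →
      r ^ k * ‖Φ ((n - k) * γ + k * (w' / m) + η)‖ < 1 := by
    refine (Filter.eventually_all_finset S).2 fun n hn =>
      (Filter.eventually_all_finset _).2 fun k hk => ?_
    by_cases hkn : k ≤ n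
    · filter_upwards [(show Continuous fun η : ℂ =>
        r ^ k * ‖Φ ((n - k) * γ + k * (w' / m) + η)‖ by fun_prop).continuousAt.eventually
        (gt_mem_nhds (by simpa using h2 n hn k hk hkn))] with η hη _ using hη
    · exact Eventually.of_forall fun z h => absurd h hkn
  obtain ⟨δ₁, hδ₁, hball⟩ := Metric.eventually_nhds_iff_ball.1 (hev3.and hev4)
  have hball' : ∀ η : ℂ, ‖η‖ < min δ₀ δ₁ → η ∈ ball (0 : ℂ) δ₁ := fun η hη => by
    simpa using (lt_min_iff.1 hη).2
  refine ⟨w', d, min δ₀ δ₁, hd, by positivity, fun η hη => (hball η (hball' η hη)).1,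
    fun n hn k hkn hkm η hη => (hball η (hball' η hη)).2 n hn k (Finset.mem_range.2 hkm) hkn,
    hconv.subset ?_ (convex_Ioo _ _)⟩
  exact Set.Ioo_subset_Ioo (neg_le_neg (min_le_left _ _)) (min_le_left _ _)

theorem sum_sumElim_const {I J : Type*} {n : ℕ} (p : Fin n → I ⊕ J) (a b : ℂ) :
    ∑ i, Sum.elim (fun _ => a) (fun _ => b) (p i)
      = (n - (Finset.univ.filter fun i => (p i).isRight).card) * a
        + (Finset.univ.filter fun i => (p i).isRight).card * b := by
  have h1 : ∀ x : I ⊕ J, Sum.elim (fun _ => a) (fun _ => b) x = if x.isRight then b else a := by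
    rintro (x | x) <;> simp
  have h2 := Finset.card_filter_add_card_filter_not (s := (Finset.univ : Finset (Fin n)))
    (fun i => (p i).isRight = true)
  rw [Finset.card_univ, Fintype.card_fin] at h2
  have h3 : (n : ℂ) = (Finset.univ.filter fun i => (p i).isRight = true).card
      + (Finset.univ.filter fun i => ¬ (p i).isRight = true).card := by exact_mod_cast h2.symm
  simp only [h1]
  rw [Finset.sum_ite, Finset.sum_const, Finset.sum_const, nsmul_eq_mul, nsmul_eq_mul, h3]
  ring

theorem prod_norm_sumElim_one_le {I J : Type*} {n : ℕ} (p : Fin n → I ⊕ J) (q : J → ℂ) {r : ℝ}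
    (hq : ∀ j, ‖q j‖ ≤ r) :
    ∏ i, ‖Sum.elim (fun _ => 1) q (p i)‖
      ≤ r ^ (Finset.univ.filter fun i => (p i).isRight).card := by
  have h1 : ∀ x : I ⊕ J, ‖Sum.elim (fun _ => 1) q x‖ ≤ if x.isRight then r else 1 := by
    rintro (x | x)
    · simp
    · simpa using hq x
  refine (Finset.prod_le_prod (fun _ _ => norm_nonneg _) fun i _ => h1 (p i)).trans ?_
  rw [Finset.prod_ite]
  simp

/-- By strict convexity of `log |Φ|`, the value of `|Φ|` at a mean of points of a segment is less
than the geometric mean of its values at these points. -/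
theorem norm_apply_mean_mul_prod_lt_one {Φ : ℂ → ℂ} {w d : ℂ} {δ : ℝ}
    (hconv : StrictConvexOn ℝ (Set.Ioo (-δ) δ) fun t : ℝ => Real.log ‖Φ (w + t * d)‖)
    {m : ℕ} (hm : m ≠ 0) (t : Fin m → ℝ) (ht : ∀ i, t i ∈ Set.Ioo (-δ) δ)
    (hne : ∃ i j, t i ≠ t j) (q : Fin m → ℂ) (hq : ∀ i, Φ (w + t i * d) * q i ^ m = 1) :
    ‖Φ (∑ i, (w + t i * d) / m) * ∏ i, q i‖ < 1 := by
  have hm' : (m : ℝ) ≠ 0 := by exact_mod_cast hm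
  have hmC : (m : ℂ) ≠ 0 := by exact_mod_cast hm
  have hjensen := hconv.map_sum_lt (t := Finset.univ) (w := fun _ => (m : ℝ)⁻¹) (p := t)
    (fun _ _ => by positivity) (by simp [hm']) (fun i _ => ht i)
    (by obtain ⟨i, j, h⟩ := hne; exact ⟨i, by simp, j, by simp, h⟩)
  have hpt : ∑ i, (w + t i * d) / m = w + ((∑ i, (m : ℝ)⁻¹ • t i : ℝ) : ℂ) * d := by
    rw [← Finset.sum_div, Finset.sum_add_distrib, ← Finset.sum_mul, ← Finset.smul_sum]
    simp
    field_simp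
  rw [hpt]
  set z := w + ((∑ i, (m : ℝ)⁻¹ • t i : ℝ) : ℂ) * d
  have hq0 : ∀ i, q i ≠ 0 := fun i h => by
    have := hq i
    simp [h, hm] at this
  have hlogq : ∀ i, Real.log ‖q i‖ = -((m : ℝ)⁻¹ * Real.log ‖Φ (w + t i * d)‖) := by
    intro i
    have h1 : Φ (w + t i * d) ≠ 0 := fun h => by
      have := hq i
      simp [h] at this
    have h2 := congrArg (fun x => Real.log ‖x‖) (hq i)
    simp only [norm_mul, norm_pow, norm_one, Real.log_one] at h2
    rw [Real.log_mul (by simpa) (by simpa using fun h => absurd h (hq0 i)), Real.log_pow] at h2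
    field_simp
    linarith
  by_cases hz : Φ z = 0
  · simp [hz]
  have hprod : (∏ i, ‖q i‖) ≠ 0 := Finset.prod_ne_zero_iff.2 fun i _ => by simpa using hq0 i
  rw [norm_mul, norm_prod]
  refine (Real.log_neg_iff (by positivity)).1 ?_
  rw [Real.log_mul (by simpa) hprod, Real.log_prod (fun i _ => by simpa using hq0 i)]
  simp only [hlogq, Finset.sum_neg_distrib]
  simp only [smul_eq_mul] at hjensen
  linarith

/-- Let `T` act diagonally on exponentials with multiplier `Φ`. Exponentials with frequencies near
`γ` approximate a point of `U`; a small perturbation with frequencies near `w / m` produces a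
prescribed `m`-th power after iteration. The inequalities `hlow` make all terms of the powers `n ∈
S` involving less than `m` factors of the perturbation negligible, strict convexity of `log |Φ|`
near `w` does the same for the cross terms of the perturbation. -/
theorem exists_mem_forall_pow_apply_pow_mem {T : EntireFunction →L[ℂ] EntireFunction} {Φ : ℂ → ℂ}
    (hT : ∀ l, T (expEntire l) = Φ l • expEntire l) (hΦ : Differentiable ℂ Φ)
    (hne : ¬ IsMultipleOfExponential Φ) {m : ℕ} (hm : m ≠ 0) {S : Finset ℕ}
    (hS : ∀ n ∈ S, n ≤ m) {γ w : ℂ} {r : ℝ} (hr0 : 0 < r) (hr1 : r < 1)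
    (hw : 1 < r ^ m * ‖Φ w‖)
    (hlow : ∀ n ∈ S, ∀ k ≤ n, k < m → r ^ k * ‖Φ ((n - k) * γ + k * (w / m))‖ < 1)
    {U : Set EntireFunction} (hU : IsOpen U) (hUne : U.Nonempty)
    {O : Set (S → EntireFunction)} (hO : IsOpen O) {v : EntireFunction}
    (hv : (fun n : S => if (n : ℕ) = m then v else 0) ∈ O) :
    ∃ u ∈ U, ∃ N : ℕ, (fun n : S => (T ^ N) (u ^ (n : ℕ))) ∈ O := by
  obtain ⟨w', d, δ, hd, hδ, hbig, hsmall, hconv⟩ := exists_segment_strictConvexOn hΦ hne hw hlow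
  have hd0 : d ≠ 0 := norm_ne_zero_iff.1 (by rw [hd]; exact one_ne_zero)
  have hmC : (m : ℂ) ≠ 0 := by exact_mod_cast hm
  set ε : ℝ := δ / (m + 1) with hε
  have hε0 : 0 < ε := by positivity
  have hεδ : ε ≤ δ := div_le_self hδ.le (by linarith [(Nat.cast_nonneg m : (0 : ℝ) ≤ m)])
  obtain ⟨I, a, hI, haU⟩ := exists_sum_expEntire_mem γ 1 one_ne_zero hε0 hU hUne
  have hcontO : Continuous fun v : EntireFunction =>
      (fun n : S => if (n : ℕ) = m then v else 0) := by
    refine continuous_pi fun n => ?_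
    split_ifs
    · exact continuous_id
    · exact continuous_const
  obtain ⟨J, b, hJ, hbO⟩ := exists_sum_expEntire_mem w' d hd0 hε0 (hO.preimage hcontO) ⟨v, hv⟩
  choose c hc using fun j : J => IsAlgClosed.exists_pow_nat_eq (b j) (Nat.pos_of_ne_zero hm)
  choose q hq using fun j : J => IsAlgClosed.exists_pow_nat_eq
    (Φ (w' + (j : ℝ) * d))⁻¹ (Nat.pos_of_ne_zero hm)
  have hJnorm : ∀ j : J, ‖((j : ℝ) : ℂ) * d‖ < ε := fun j => by
    rw [norm_mul, hd, mul_one, Complex.norm_real]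
    exact hJ j
  have hbig' : ∀ j : J, 1 < r ^ m * ‖Φ (w' + (j : ℝ) * d)‖ := fun j =>
    hbig _ ((hJnorm j).trans_le hεδ)
  have hΦ0 : ∀ j : J, Φ (w' + (j : ℝ) * d) ≠ 0 := fun j h => by
    have := hbig' j
    simp [h] at this
    linarith
  have hqr : ∀ j, ‖q j‖ < r := fun j => by
    refine lt_of_pow_lt_pow_left₀ m hr0.le ?_
    rw [← norm_pow, hq, norm_inv, inv_lt_iff_one_lt_mul₀ (by simpa using hΦ0 j)]
    exact hbig' j
  have hone' : ∀ j : J, Φ (w' + (j : ℝ) * d) * q j ^ m = 1 := fun j => by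
    rw [hq, mul_inv_cancel₀ (hΦ0 j)]
  set C : I ⊕ J → ℂ := Sum.elim a c
  set Q : I ⊕ J → ℂ := Sum.elim (fun _ => 1) q
  set f : I ⊕ J → ℂ := Sum.elim (fun s => γ + (s : ℝ) * 1) fun j => (w' + (j : ℝ) * d) / m
  have hone : ∀ j, Φ (m * f (Sum.inr j)) * Q (Sum.inr j) ^ m = 1 := fun j => by
    have : (m : ℂ) * f (Sum.inr j) = w' + (j : ℝ) * d := mul_div_cancel₀ _ hmC
    rw [this]
    exact hone' j
  -- The shift of a frequency from its base point `γ` or `w' / m`.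
  set η : I ⊕ J → ℂ := Sum.elim (fun s => ((s : ℝ) : ℂ)) fun j => (j : ℝ) * d / m
  have hη : ∀ x, ‖η x‖ ≤ ε := by
    rintro (s | j)
    · have : ‖((s : ℝ) : ℂ)‖ = |(s : ℝ)| := Complex.norm_real _
      exact this.le.trans (hI s).le
    · have h1 : (1 : ℝ) ≤ m := by exact_mod_cast Nat.one_le_iff_ne_zero.2 hm
      simp only [η, Sum.elim_inr, norm_div, Complex.norm_natCast]
      exact (div_le_self (norm_nonneg _) h1).trans (hJnorm j).le
  have hf : ∀ x, f x = Sum.elim (fun _ => γ) (fun _ => w' / m) x + η x := by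
    rintro (s | j) <;> simp [f, η, add_div]
  have hlt : ∀ n ∈ S, ∀ p : Fin n → I ⊕ J, ¬ (n = m ∧ ∃ j, ∀ i, p i = Sum.inr j) →
      ‖Φ (∑ i, f (p i)) * ∏ i, Q (p i)‖ < 1 := by
    intro n hn p hp
    set k := (Finset.univ.filter fun i => (p i).isRight).card with hk
    have hkn : k ≤ n := (Finset.card_filter_le _ _).trans_eq (Finset.card_fin n)
    rcases lt_or_ge k m with hkm | hkm
    · have hsum : ∑ i, f (p i) = (n - k) * γ + k * (w' / m) + ∑ i, η (p i) := by
        simp only [hf, Finset.sum_add_distrib]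
        rw [sum_sumElim_const]
      have hηsum : ‖∑ i, η (p i)‖ < δ := by
        calc ‖∑ i, η (p i)‖ ≤ ∑ _i : Fin n, ε := norm_sum_le_of_le _ fun i _ => hη _
          _ = n * ε := by simp
          _ ≤ m * ε := by
            gcongr
            exact hS n hn
          _ < (m + 1) * ε := by linarith
          _ = δ := by
            rw [hε]
            field_simp
      rw [hsum, norm_mul, norm_prod, mul_comm]
      refine lt_of_le_of_lt ?_ (hsmall n hn k hkn hkm _ hηsum)
      gcongr
      exact prod_norm_sumElim_one_le p q fun j => (hqr j).le
    · have hnm : n = m := le_antisymm (hS n hn) (hkm.trans hkn)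
      subst hnm
      have hall : ∀ i, (p i).isRight = true := by
        have := Finset.card_filter_eq_iff.1
          ((le_antisymm hkn hkm).trans (Fintype.card_fin n).symm : _ = Fintype.card (Fin n))
        simpa using this
      choose g hg using fun i => Sum.isRight_iff.1 (hall i)
      have hnconst : ∃ i j, ((g i : ℝ)) ≠ (g j : ℝ) := by
        by_contra! hcon
        exact hp ⟨rfl, g ⟨0, Nat.pos_of_ne_zero hm⟩, fun i => by
          rw [hg i]
          exact congrArg Sum.inr (Subtype.ext (hcon i _))⟩
      have := norm_apply_mean_mul_prod_lt_one hconv hm (fun i => (g i : ℝ))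
        (fun i => abs_lt.1 ((hJ _).trans_le hεδ)) hnconst (fun i => q (g i)) fun i => hone' (g i)
      simpa only [hg, f, Q, Sum.elim_inr] using this
  set u : ℕ → EntireFunction := fun N => ∑ x, (C x * Q x ^ N) • expEntire (f x)
  have hu : Tendsto u atTop (𝓝 (∑ s : I, a s • expEntire (γ + (s : ℝ) * 1))) := by
    have heq : u = fun N => ∑ s : I, a s • expEntire (γ + (s : ℝ) * 1)
        + ∑ j : J, (c j * q j ^ N) • expEntire ((w' + (j : ℝ) * d) / m) := by
      funext N
      simp [u, C, Q, f, Fintype.sum_sum_type]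
    have h0 : Tendsto (fun N => ∑ j : J, (c j * q j ^ N) • expEntire ((w' + (j : ℝ) * d) / m))
        atTop (𝓝 (∑ j : J, (0 : EntireFunction))) := by
      refine tendsto_finsetSum _ fun j _ => ?_
      have := ((tendsto_pow_atTop_nhds_zero_of_norm_lt_one
        ((hqr j).trans hr1)).const_mul (c j)).smul_const (expEntire ((w' + (j : ℝ) * d) / m))
      simpa using this
    rw [heq]
    simpa using tendsto_const_nhds.add h0
  have htuple : Tendsto (fun N => (fun n : S => (T ^ N) (u N ^ (n : ℕ)))) atTop
      (𝓝 (fun n : S => if (n : ℕ) = m then ∑ j : J, b j • expEntire (w' + (j : ℝ) * d)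
        else 0)) := by
    refine tendsto_pi_nhds.2 fun n => ?_
    have h := tendsto_pow_apply_sum_expEntire_pow hT C Q f hm (hlt n n.2) hone
    have hlim : ∑ j : J, C (Sum.inr j) ^ m • expEntire (m * f (Sum.inr j))
        = ∑ j : J, b j • expEntire (w' + (j : ℝ) * d) := by
      refine Finset.sum_congr rfl fun j _ => ?_
      have : (m : ℂ) * f (Sum.inr j) = w' + (j : ℝ) * d := mul_div_cancel₀ _ hmC
      rw [this]
      simp only [C, Sum.elim_inr, hc]
    rw [hlim] at h
    exact h
  obtain ⟨N, hN1, hN2⟩ := ((hu.eventually (hU.mem_nhds haU)).and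
    (htuple.eventually (hO.mem_nhds hbO))).exists
  exact ⟨u N, hN1, N, hN2⟩

/-! ### The Baire category argument -/

/-- If each open condition on the iterates of the powers `f ^ n`, `n ∈ S m`, can be met by some `f`
in any given open set, then a single `f` meets all of them. -/
theorem exists_forall_pow_apply_pow_mem (T : EntireFunction →L[ℂ] EntireFunction) (K : Set ℂ)
    (S : ℕ → Finset ℕ)
    (h : ∀ m : ℕ, 1 ≤ m → ∀ U : Set EntireFunction, IsOpen U → U.Nonempty →
      ∀ O : Set (S m → EntireFunction), IsOpen O → ∀ v : EntireFunction,
        (fun n : S m => if (n : ℕ) = m then v else 0) ∈ O →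
          ∃ u ∈ U, ∃ c ∈ K, ∃ N : ℕ, (fun n : S m => c • (T ^ N) (u ^ (n : ℕ))) ∈ O) :
    ∃ f : EntireFunction, ∀ m : ℕ, 1 ≤ m →
      ∀ O : Set (S m → EntireFunction), IsOpen O → ∀ v : EntireFunction,
        (fun n : S m => if (n : ℕ) = m then v else 0) ∈ O →
          ∃ c ∈ K, ∃ N : ℕ, (fun n : S m => c • (T ^ N) (f ^ (n : ℕ))) ∈ O := by
  have hsc : ∀ m, SecondCountableTopology (S m → EntireFunction) := fun m => inferInstance
  let ι := Σ m : ℕ, TopologicalSpace.countableBasis (S m → EntireFunction)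
  have : Countable ι := inferInstance
  let cond : ι → Prop := fun i =>
    1 ≤ i.1 ∧ ∃ v : EntireFunction, (fun n : S i.1 => if (n : ℕ) = i.1 then v else 0) ∈ i.2.1
  let G : ι → Set EntireFunction := fun i =>
    {f | cond i → ∃ c ∈ K, ∃ N : ℕ, (fun n : S i.1 => c • (T ^ N) (f ^ (n : ℕ))) ∈ i.2.1}
  have hbasis := fun m => TopologicalSpace.isBasis_countableBasis (S m → EntireFunction)
  have hGopen : ∀ i, IsOpen (G i) := by
    intro i
    by_cases hi : cond i
    · have heq : G i = ⋃ c ∈ K, ⋃ N : ℕ,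
          (fun f : EntireFunction => (fun n : S i.1 => c • (T ^ N) (f ^ (n : ℕ)))) ⁻¹' i.2.1 := by
        ext f
        simp [G, hi]
      rw [heq]
      refine isOpen_biUnion fun c _ => isOpen_iUnion fun N => ?_
      refine ((hbasis i.1).isOpen i.2.2).preimage (continuous_pi fun n => ?_)
      exact ((T ^ N).continuous.comp (continuous_pow (n : ℕ))).const_smul c
    · have heq : G i = Set.univ := Set.eq_univ_of_forall fun f hc => absurd hc hi
      rw [heq]
      exact isOpen_univ
  have hGdense : ∀ i, Dense (G i) := by
    intro i
    refine dense_iff_inter_open.2 fun U hU hUne => ?_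
    by_cases hi : cond i
    · obtain ⟨hm, v, hv⟩ := hi
      obtain ⟨u, huU, c, hc, N, hN⟩ := h i.1 hm U hU hUne i.2.1 ((hbasis i.1).isOpen i.2.2) v hv
      exact ⟨u, huU, fun _ => ⟨c, hc, N, hN⟩⟩
    · obtain ⟨u, hu⟩ := hUne
      exact ⟨u, hu, fun hc => absurd hc hi⟩
  obtain ⟨f, hf⟩ := (dense_iInter_of_isOpen hGopen hGdense).nonempty
  refine ⟨f, fun m hm O hO v hv => ?_⟩
  obtain ⟨B, hB, hvB, hBO⟩ := (hbasis m).exists_subset_of_mem_open hv hO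
  obtain ⟨c, hc, N, hN⟩ := Set.mem_iInter.1 hf ⟨m, B, hB⟩ ⟨hm, v, hvB⟩
  exact ⟨c, hc, N, hBO hN⟩

/-! ### The choice of the base frequencies -/

theorem exists_radius_pow_mul_lt_one {m : ℕ} (hm : m ≠ 0) {A : ℝ} (hA : 1 < A) (a : ℕ → ℝ)
    (ha : ∀ k < m, a k < A ^ ((k : ℝ) / m)) :
    ∃ r : ℝ, 0 < r ∧ r < 1 ∧ 1 < r ^ m * A ∧ ∀ k < m, r ^ k * a k < 1 := by
  have hA0 : 0 < A := by linarith
  have hm' : (m : ℝ) ≠ 0 := by exact_mod_cast hm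
  have hmpos : (0 : ℝ) < m := by positivity
  -- At this radius `r ^ m * A = 1`, the other inequalities being strict; then enlarge it slightly.
  set r₀ : ℝ := A ^ (-(m : ℝ)⁻¹) with hr₀
  have hr₀pos : 0 < r₀ := Real.rpow_pos_of_pos hA0 _
  have hr₀1 : r₀ < 1 := Real.rpow_lt_one_of_one_lt_of_neg hA (by simpa using hmpos)
  have hpow : ∀ k : ℕ, r₀ ^ k * A ^ ((k : ℝ) / m) = 1 := fun k => by
    rw [hr₀, ← Real.rpow_natCast, ← Real.rpow_mul hA0.le, ← Real.rpow_add hA0]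
    convert Real.rpow_zero A using 2
    field_simp
    ring
  have hev : ∀ᶠ r in 𝓝 r₀, r < 1 ∧ ∀ k ∈ Finset.range m, r ^ k * a k < 1 := by
    refine (gt_mem_nhds hr₀1).and ((Filter.eventually_all_finset _).2 fun k hk => ?_)
    refine (show Continuous fun r : ℝ => r ^ k * a k by fun_prop).continuousAt.eventually
      (gt_mem_nhds ?_)
    calc r₀ ^ k * a k < r₀ ^ k * A ^ ((k : ℝ) / m) := by
          gcongr
          exact ha k (Finset.mem_range.1 hk)
      _ = 1 := hpow k
  obtain ⟨r, ⟨hr1, hrk⟩, hr⟩ :=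
    ((hev.filter_mono nhdsWithin_le_nhds).and (self_mem_nhdsWithin (s := Set.Ioi r₀))).exists
  have hr : r₀ < r := hr
  refine ⟨r, hr₀pos.trans hr, hr1, ?_, fun k hk => hrk k (Finset.mem_range.2 hk)⟩
  have h1 : r₀ ^ m * A = 1 := by simpa [div_self hm'] using hpow m
  calc 1 = r₀ ^ m * A := h1.symm
    _ < r ^ m * A := by gcongr

/-- By the maximum principle, at a point `w` where `|φ|` is maximal on a disc centred at `0`, the
modulus is strictly larger than at the other points of the segment from `0` to `w`. -/
theorem exists_norm_apply_smul_lt {φ : ℂ → ℂ} (hφ : Differentiable ℂ φ)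
    (hnc : ¬ ∃ c : ℂ, ∀ z : ℂ, φ z = c) :
    ∃ w : ℂ, ∀ t : ℝ, 0 ≤ t → t < 1 → ‖φ (t * w)‖ < ‖φ w‖ := by
  obtain ⟨w, hw, hmax⟩ := (isCompact_closedBall (0 : ℂ) 1).exists_isMaxOn ⟨0, by simp⟩
    hφ.continuous.norm.continuousOn
  have hw1 : ‖w‖ ≤ 1 := by simpa using hw
  refine ⟨w, fun t ht0 ht1 => ?_⟩
  have htw : (t : ℂ) * w ∈ ball (0 : ℂ) 1 := by
    rw [mem_ball_zero_iff, norm_mul, Complex.norm_real, Real.norm_eq_abs, abs_of_nonneg ht0]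
    nlinarith [norm_nonneg w]
  refine lt_of_le_of_ne (hmax (ball_subset_closedBall htw)) fun heq => hnc ⟨φ (t * w), fun z => ?_⟩
  have hmax' : IsMaxOn (norm ∘ φ) (ball 0 1) (t * w) := fun z hz => by
    have := hmax (ball_subset_closedBall hz)
    simpa [heq] using this
  have hconst := Complex.eqOn_of_isPreconnected_of_isMaxOn_norm
    (convex_ball (0 : ℂ) 1).isPreconnected isOpen_ball hφ.differentiableOn htw hmax'
  have hev : φ =ᶠ[𝓝 0] fun _ => φ (t * w) := by
    filter_upwards [ball_mem_nhds (0 : ℂ) one_pos] with y hy using hconst hy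
  exact congrFun (AnalyticOnNhd.eq_of_eventuallyEq (𝕜 := ℂ) (fun z _ => hφ.analyticAt z)
    (fun z _ => analyticAt_const) hev) z

theorem exists_norm_lt_one {φ : ℂ → ℂ} (hφ : Differentiable ℂ φ)
    (hnc : ¬ ∃ c : ℂ, ∀ z : ℂ, φ z = c) : ∃ z, ‖φ z‖ < 1 := by
  by_contra! h
  have h0 : ∀ z, φ z ≠ 0 := fun z hz => by
    have := h z
    simp [hz] at this
    linarith
  have hb : Bornology.IsBounded (Set.range fun z => (φ z)⁻¹) := by
    refine isBounded_iff_forall_norm_le.2 ⟨1, ?_⟩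
    rintro _ ⟨z, rfl⟩
    simpa using inv_le_one_of_one_le₀ (h z)
  refine hnc ⟨φ 0, fun z => inv_injective ?_⟩
  exact (hφ.inv h0).apply_eq_apply_of_bounded hb z 0

theorem exists_one_lt_norm {φ : ℂ → ℂ} (hφ : Differentiable ℂ φ)
    (hnc : ¬ ∃ c : ℂ, ∀ z : ℂ, φ z = c) : ∃ z, 1 < ‖φ z‖ := by
  by_contra! h
  have hb : Bornology.IsBounded (Set.range φ) := by
    refine isBounded_iff_forall_norm_le.2 ⟨1, ?_⟩
    rintro _ ⟨z, rfl⟩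
    exact h z
  exact hnc ⟨φ 0, fun z => hφ.apply_eq_apply_of_bounded hb z 0⟩

/-- There is a segment from a point `z` with `|φ z| < 1` to a point `z + ω` with `|φ (z + ω)| > 1`
along which `log |φ|` stays strictly below the linear function with values `0` at `z` and
`log |φ (z + ω)|` at `z + ω`. -/
theorem exists_norm_apply_segment_lt_rpow {φ : ℂ → ℂ} (hφ : Differentiable ℂ φ)
    (hnc : ¬ ∃ c : ℂ, ∀ z : ℂ, φ z = c) :
    ∃ z ω : ℂ, 1 < ‖φ (z + ω)‖ ∧
      ∀ t : ℝ, 0 ≤ t → t < 1 → ‖φ (z + t * ω)‖ < ‖φ (z + ω)‖ ^ t := by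
  obtain ⟨z₀, hz₀⟩ := exists_norm_lt_one hφ hnc
  obtain ⟨z₁, hz₁⟩ := exists_one_lt_norm hφ hnc
  set G : ℝ → ℝ := fun s => ‖φ (z₀ + s * (z₁ - z₀))‖ with hG
  have hGc : Continuous G := (hφ.continuous.comp (by fun_prop)).norm
  have hG0 : G 0 < 1 := by simpa [hG] using hz₀
  have hG1 : 1 < G 1 := by simpa [hG] using hz₁
  obtain ⟨δ, hδ, hball⟩ := Metric.eventually_nhds_iff_ball.1
    (hGc.continuousAt.eventually (gt_mem_nhds hG0))
  set s₀ : ℝ := min (δ / 2) 1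
  have hs₀ : 0 < s₀ := by positivity
  have hsmall : ∀ s, 0 ≤ s → s < s₀ → G s < 1 := fun s h0 hs => by
    refine hball s ?_
    have := hs.trans_le (min_le_left _ _)
    rw [mem_ball, Real.dist_eq, sub_zero, abs_of_nonneg h0]
    linarith
  -- Dividing by `s ^ 2` instead of `s` makes the resulting inequality strict.
  have hcont : ContinuousOn (fun s => Real.log (max (G s) 1) / s ^ 2) (Set.Icc s₀ 1) := by
    refine ContinuousOn.div (ContinuousOn.log (by fun_prop) fun s _ => ?_) (by fun_prop)
      fun s hs => ?_
    · exact (lt_of_lt_of_le one_pos (le_max_right _ _)).ne'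
    · exact pow_ne_zero _ (hs₀.trans_le hs.1).ne'
  obtain ⟨s, hs, hmax⟩ := isCompact_Icc.exists_isMaxOn ⟨1, min_le_right _ _, le_rfl⟩ hcont
  have hspos : 0 < s := hs₀.trans_le hs.1
  have hlogpos : 0 < Real.log (max (G s) 1) := by
    have h1 : Real.log (max (G 1) 1) / 1 ^ 2 ≤ Real.log (max (G s) 1) / s ^ 2 :=
      hmax ⟨min_le_right _ _, le_rfl⟩
    rw [max_eq_left hG1.le, one_pow, div_one] at h1
    have h2 := (Real.log_pos hG1).trans_le h1
    have := mul_pos h2 (pow_pos hspos 2)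
    rwa [div_mul_cancel₀ _ (pow_pos hspos 2).ne'] at this
  have hGs : 1 < G s := by
    by_contra! hcon
    rw [max_eq_right hcon, Real.log_one] at hlogpos
    exact lt_irrefl _ hlogpos
  rw [max_eq_left hGs.le] at hlogpos
  refine ⟨z₀, s * (z₁ - z₀), hGs, fun t ht0 ht1 => ?_⟩
  have hGt : ‖φ (z₀ + t * (s * (z₁ - z₀)))‖ = G (t * s) := by
    simp only [hG]
    push_cast
    rw [mul_assoc]
  change _ < G s ^ t
  rw [hGt]
  rcases lt_or_ge (t * s) s₀ with hts | hts
  · exact (hsmall _ (by positivity) hts).trans_le (Real.one_le_rpow hGs.le ht0)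
  · have htpos : 0 < t := by
      by_contra! hcon
      nlinarith
    have h1 : Real.log (max (G (t * s)) 1) / (t * s) ^ 2 ≤ Real.log (max (G s) 1) / s ^ 2 :=
      hmax ⟨hts, by nlinarith [hs.2]⟩
    rw [max_eq_left hGs.le, div_le_div_iff₀ (by positivity) (by positivity)] at h1
    have h2 : Real.log (max (G (t * s)) 1) ≤ t ^ 2 * Real.log (G s) := by
      refine le_of_mul_le_mul_right ?_ (pow_pos hspos 2)
      linarith
    have h3 : Real.log (max (G (t * s)) 1) < t * Real.log (G s) :=
      h2.trans_lt (mul_lt_mul_of_pos_right (by nlinarith) hlogpos)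
    refine (le_max_left (G (t * s)) 1).trans_lt ?_
    rw [← Real.log_rpow (by linarith)] at h3
    exact (Real.log_lt_log_iff (by positivity) (Real.rpow_pos_of_pos (by linarith) _)).1 h3

/-! ### Multiples of exponentials -/

theorem convolutionOperator_apply_of_eq_exp {φ : ℂ → ℂ} (hφ : Differentiable ℂ φ)
    (hexp : IsExponentialType φ) {c a : ℂ} (h : ∀ z, φ z = c * cexp (a * z)) (f : EntireFunction)
    (z : ℂ) : (convolutionOperator φ hφ hexp f).toFun z = c * f.toFun (z + a) := by
  have h1 := hasSum_convolutionFun hφ hexp f.differentiable z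
  have h2 := (Complex.hasSum_taylorSeries_of_entire f.differentiable z (z + a)).mul_left c
  have hcoeff : ∀ n, taylorCoeffZero φ n = c * a ^ n / n.factorial := fun n => by
    rw [taylorCoeffZero, show φ = fun z => c * cexp (a * z) from funext h,
      iteratedDeriv_const_mul_field, iteratedDeriv_cexp_const_mul]
    simp
  refine h1.unique ?_
  have h3 : (fun n : ℕ => taylorCoeffZero φ n * iteratedDeriv n f.toFun z)
      = fun n : ℕ => c * ((n.factorial : ℂ)⁻¹ • (z + a - z) ^ n • iteratedDeriv n f.toFun z) := by
    funext n
    rw [hcoeff, add_sub_cancel_left]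
    simp only [smul_eq_mul]
    ring
  rw [h3]
  exact h2

theorem convolutionOperator_pow_apply_of_eq_exp {φ : ℂ → ℂ} (hφ : Differentiable ℂ φ)
    (hexp : IsExponentialType φ) {c a : ℂ} (h : ∀ z, φ z = c * cexp (a * z)) (N : ℕ)
    (f : EntireFunction) (z : ℂ) :
    ((convolutionOperator φ hφ hexp ^ N) f).toFun z = c ^ N * f.toFun (z + N * a) := by
  induction N generalizing z with
  | zero => simp
  | succ N ih =>
    rw [pow_succ', mul_apply_eq_comp, convolutionOperator_apply_of_eq_exp hφ hexp h, ih,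
      pow_succ', mul_assoc]
    congr 3
    push_cast
    ring

/-- A multiple `κ g ^ 2` of a square is not close to the identity on a disc: close to the identity
it has no double zero, hence no zero at all near `0`, which contradicts the minimum principle. -/
theorem not_forall_norm_mul_sq_sub_lt {g : ℂ → ℂ} (hg : Differentiable ℂ g) (κ : ℂ) :
    ¬ ∀ z ∈ closedBall (0 : ℂ) 2, ‖κ * g z ^ 2 - z‖ < 1 / 4 := by
  intro h
  set F : ℂ → ℂ := fun z => κ * g z ^ 2 with hF
  have hFd : Differentiable ℂ F := (hg.pow 2).const_mul κ
  have hF' : ∀ z, HasDerivAt F (κ * (2 * g z * deriv g z)) z := fun z => by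
    simpa using ((hg z).hasDerivAt.pow 2).const_mul κ
  have hne : ∀ z ∈ closedBall (0 : ℂ) 1, F z ≠ 0 := by
    intro z hz h0
    have hz1 : ‖z‖ ≤ 1 := by simpa using hz
    have hderiv : deriv F z = 0 := by
      rw [(hF' z).deriv]
      rcases mul_eq_zero.1 h0 with h1 | h1
      · simp [h1]
      · simp [pow_eq_zero_iff two_ne_zero |>.1 h1]
    have hb := Complex.norm_deriv_le_of_forall_mem_sphere_norm_le (f := fun y => F y - y) (c := z)
      one_pos (hFd.sub differentiable_id).diffContOnCl (C := 1 / 4) fun y hy => by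
        refine (h y ?_).le
        have hy1 : ‖y - z‖ = 1 := by simpa [dist_eq_norm] using hy
        have := norm_add_le (y - z) z
        rw [sub_add_cancel] at this
        rw [mem_closedBall_zero_iff]
        linarith
    have hd : deriv (fun y => F y - y) z = -1 := by
      refine ((hFd z).hasDerivAt.sub (hasDerivAt_id z)).deriv.trans ?_
      rw [hderiv, zero_sub]
    rw [hd] at hb
    norm_num at hb
  have hinv : DiffContOnCl ℂ (fun z => (F z)⁻¹) (ball 0 1) := by
    refine DifferentiableOn.diffContOnCl fun z hz => ?_
    rw [closure_ball _ one_ne_zero] at hz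
    exact ((hFd z).inv (hne z hz)).differentiableWithinAt
  have hbound := Complex.norm_le_of_forall_mem_frontier_norm_le isBounded_ball hinv (C := 4 / 3)
    (z := 0) (fun z hz => by
      rw [frontier_ball _ one_ne_zero, mem_sphere_zero_iff_norm] at hz
      have h1 := h z (by rw [mem_closedBall_zero_iff, hz]; norm_num)
      have h2 : ‖z‖ - ‖F z‖ ≤ ‖F z - z‖ := by
        rw [norm_sub_rev]
        exact norm_sub_norm_le _ _
      have h3 : (3 / 4 : ℝ) ≤ ‖F z‖ := by
        rw [hz] at h2
        linarith
      rw [norm_inv]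
      calc ‖F z‖⁻¹ ≤ (3 / 4 : ℝ)⁻¹ := by gcongr
        _ = 4 / 3 := by norm_num)
    (subset_closure (mem_ball_self one_pos))
  have h0 := h 0 (by simp)
  rw [sub_zero] at h0
  have hpos : 0 < ‖F 0‖ := norm_pos_iff.2 (hne 0 (by simp))
  rw [norm_inv, inv_le_comm₀ hpos (by norm_num)] at hbound
  have : ‖F 0‖ < 1 / 4 := h0
  norm_num at hbound
  linarith

theorem not_isSupercyclicVector_sq_of_isMultipleOfExponential {φ : ℂ → ℂ}
    (hφ : Differentiable ℂ φ) (hexp : IsExponentialType φ) (h : IsMultipleOfExponential φ)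
    (f : EntireFunction) : ¬ IsSupercyclicVector (convolutionOperator φ hφ hexp) (f ^ 2) := by
  intro hsc
  obtain ⟨c, a, h⟩ := h
  have hnear := idEntire.eventually_norm_sub_lt 2 (ε := 1 / 4) (by norm_num)
  obtain ⟨y, ⟨κ, N, rfl⟩, hy⟩ := (mem_closure_iff_frequently.1 (hsc idEntire)).and_eventually
    hnear |>.exists
  refine not_forall_norm_mul_sq_sub_lt (g := fun z => f.toFun (z + N * a))
    (f.differentiable.comp (by fun_prop)) (κ * c ^ N) fun z hz => ?_
  have := hy z hz
  rwa [EntireFunction.toFun_smul, convolutionOperator_pow_apply_of_eq_exp hφ hexp h,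
    EntireFunction.toFun_pow, toFun_idEntire, ← mul_assoc] at this

/-! ### Hypercyclic powers and supercyclic algebras -/

theorem IsMultipleOfExponential.of_const_mul {φ : ℂ → ℂ} {Λ : ℂ} (hΛ : Λ ≠ 0)
    (h : IsMultipleOfExponential fun z => Λ * φ z) : IsMultipleOfExponential φ := by
  obtain ⟨c, a, h⟩ := h
  refine ⟨Λ⁻¹ * c, a, fun z => ?_⟩
  rw [mul_assoc, ← h z, inv_mul_cancel_left₀ hΛ]

theorem const_smul_pow_apply (T : EntireFunction →L[ℂ] EntireFunction) (Λ : ℂ) (N : ℕ)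
    (x : EntireFunction) : ((Λ • T) ^ N) x = Λ ^ N • (T ^ N) x := by
  induction N with
  | zero => simp
  | succ N ih =>
    rw [pow_succ', mul_apply_eq_comp, ih, smul_apply, map_smul, smul_smul, ← pow_succ',
      pow_succ' T, mul_apply_eq_comp]

theorem exists_forall_isHypercyclicVector_pow {φ : ℂ → ℂ} (hφ : Differentiable ℂ φ)
    (hexp : IsExponentialType φ) (hnc : ¬ ∃ c : ℂ, ∀ z : ℂ, φ z = c)
    (hne : ¬ IsMultipleOfExponential φ) :
    ∃ f : EntireFunction, ∀ m : ℕ, 1 ≤ m →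
      IsHypercyclicVector (convolutionOperator φ hφ hexp) (f ^ m) := by
  obtain ⟨z, ω, hbig, hlt⟩ := exists_norm_apply_segment_lt_rpow hφ hnc
  have key := exists_forall_pow_apply_pow_mem (convolutionOperator φ hφ hexp) {1} (fun m => {m})
    fun m hm U hU hUne O hO v hv => by
      have hm0 : m ≠ 0 := Nat.one_le_iff_ne_zero.1 hm
      have hmpos : (0 : ℝ) < m := by positivity
      have hmC : (m : ℂ) ≠ 0 := by exact_mod_cast hm0
      obtain ⟨r, hr0, hr1, hrm, hrk⟩ := exists_radius_pow_mul_lt_one hm0 hbig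
        (fun k => ‖φ (z + ((k / m : ℝ) : ℂ) * ω)‖) fun k hk => hlt _ (by positivity)
          ((div_lt_one hmpos).2 (by exact_mod_cast hk))
      obtain ⟨u, hu, N, hN⟩ := exists_mem_forall_pow_apply_pow_mem
        (convolutionOperator_expEntire φ hφ hexp) hφ hne hm0 (S := {m})
        (fun n hn => (Finset.mem_singleton.1 hn).le) (γ := z / m) (w := z + ω) hr0 hr1 hrm
        (fun n hn k _ hkm => by
          rw [Finset.mem_singleton.1 hn]
          have hpt : ((m : ℂ) - k) * (z / m) + k * ((z + ω) / m)
              = z + ((k / m : ℝ) : ℂ) * ω := by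
            push_cast
            field_simp
            ring
          rw [hpt]
          exact hrk k hkm) hU hUne hO hv
      exact ⟨u, hu, 1, rfl, N, by simpa only [one_smul] using hN⟩
  obtain ⟨f, hf⟩ := key
  refine ⟨f, fun m hm => dense_iff_inter_open.2 fun V hV hVne => ?_⟩
  obtain ⟨v, hv⟩ := hVne
  obtain ⟨c, rfl, N, hN⟩ := hf m hm
    ((fun x : ({m} : Finset ℕ) → EntireFunction => x ⟨m, Finset.mem_singleton_self m⟩) ⁻¹' V)
    (hV.preimage (continuous_apply (⟨m, Finset.mem_singleton_self m⟩ : ({m} : Finset ℕ)))) v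
    (by simpa using hv)
  exact ⟨_, by simpa using hN, N, rfl⟩

/-- For each `m`, suitable multiples `c • φ(D) ^ N` send the powers `f ^ n`, `n < m`, close to `0`
and `f ^ m` close to any prescribed function. -/
theorem exists_forall_smul_pow_apply_pow_mem {φ : ℂ → ℂ} (hφ : Differentiable ℂ φ)
    (hexp : IsExponentialType φ) (hnc : ¬ ∃ c : ℂ, ∀ z : ℂ, φ z = c)
    (hne : ¬ IsMultipleOfExponential φ) :
    ∃ f : EntireFunction, ∀ m : ℕ, 1 ≤ m →
      ∀ O : Set (Finset.Icc 1 m → EntireFunction), IsOpen O → ∀ v : EntireFunction,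
        (fun n : Finset.Icc 1 m => if (n : ℕ) = m then v else 0) ∈ O →
          ∃ (c : ℂ) (N : ℕ), (fun n : Finset.Icc 1 m =>
            c • (convolutionOperator φ hφ hexp ^ N) (f ^ (n : ℕ))) ∈ O := by
  obtain ⟨w, hw⟩ := exists_norm_apply_smul_lt hφ hnc
  have hwpos : 0 < ‖φ w‖ := (norm_nonneg _).trans_lt (hw 0 le_rfl one_pos)
  have key := exists_forall_pow_apply_pow_mem (convolutionOperator φ hφ hexp) Set.univ
    (fun m => Finset.Icc 1 m) fun m hm U hU hUne O hO v hv => by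
      have hm0 : m ≠ 0 := Nat.one_le_iff_ne_zero.1 hm
      have hmpos : (0 : ℝ) < m := by positivity
      -- A scalar between `|φ w|` and the values of `|φ|` at the points `k w / m`.
      have hev : ∀ᶠ a in 𝓝 ‖φ w‖, 0 < a ∧
          ∀ k ∈ Finset.range m, ‖φ (((k / m : ℝ) : ℂ) * w)‖ < a :=
        (lt_mem_nhds hwpos).and ((Filter.eventually_all_finset _).2 fun k hk =>
          lt_mem_nhds (hw _ (by positivity)
            ((div_lt_one hmpos).2 (by exact_mod_cast Finset.mem_range.1 hk))))
      obtain ⟨a, ⟨ha0, hak⟩, haw⟩ :=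
        ((hev.filter_mono nhdsWithin_le_nhds).and (self_mem_nhdsWithin (s := Set.Iio ‖φ w‖))).exists
      have haw : a < ‖φ w‖ := haw
      set Λ : ℂ := ((a⁻¹ : ℝ) : ℂ) with hΛ
      have hΛ0 : Λ ≠ 0 := by
        rw [hΛ]
        exact_mod_cast (inv_pos.2 ha0).ne'
      have hΛn : ∀ y, ‖Λ * φ y‖ = ‖φ y‖ / a := fun y => by
        rw [norm_mul, hΛ, Complex.norm_real, norm_inv, Real.norm_eq_abs, abs_of_pos ha0,
          inv_mul_eq_div]
      have hA : 1 < ‖Λ * φ w‖ := by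
        rw [hΛn, one_lt_div ha0]
        exact haw
      obtain ⟨r, hr0, hr1, hrm, hrk⟩ := exists_radius_pow_mul_lt_one hm0 hA
        (fun k => ‖Λ * φ (((k / m : ℝ) : ℂ) * w)‖) fun k hk => by
          refine lt_of_lt_of_le ?_ (Real.one_le_rpow hA.le (by positivity))
          rw [hΛn, div_lt_one ha0]
          exact hak k (Finset.mem_range.2 hk)
      obtain ⟨u, hu, N, hN⟩ := exists_mem_forall_pow_apply_pow_mem
        (T := Λ • convolutionOperator φ hφ hexp) (Φ := fun y => Λ * φ y)
        (fun l => by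
          rw [smul_apply, convolutionOperator_expEntire, smul_smul])
        (hφ.const_mul Λ) (fun h => hne (h.of_const_mul hΛ0)) hm0
        (fun n hn => (Finset.mem_Icc.1 hn).2) (γ := 0) hr0 hr1 hrm
        (fun n hn k _ hkm => by
          have hpt : ((n : ℂ) - k) * 0 + k * (w / m) = ((k / m : ℝ) : ℂ) * w := by
            push_cast
            ring
          rw [hpt]
          exact hrk k hkm) hU hUne hO hv
      refine ⟨u, hu, Λ ^ N, trivial, N, ?_⟩
      simpa only [const_smul_pow_apply] using hN
  obtain ⟨f, hf⟩ := key
  refine ⟨f, fun m hm O hO v hv => ?_⟩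
  obtain ⟨c, -, N, hN⟩ := hf m hm O hO v hv
  exact ⟨c, N, hN⟩

/-- The non-unital algebra generated by `f`, consisting of the `P(f)` with `P` a polynomial such
that `P(0) = 0`. -/
noncomputable def nonUnitalPolynomials (f : EntireFunction) :
    NonUnitalSubalgebra ℂ EntireFunction where
  carrier := {x | ∃ P : Polynomial ℂ, P.coeff 0 = 0 ∧ Polynomial.aeval f P = x}
  add_mem' := by
    rintro _ _ ⟨P, hP, rfl⟩ ⟨Q, hQ, rfl⟩
    exact ⟨P + Q, by simp [hP, hQ], map_add _ _ _⟩
  zero_mem' := ⟨0, by simp, map_zero _⟩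
  mul_mem' := by
    rintro _ _ ⟨P, hP, rfl⟩ ⟨Q, hQ, rfl⟩
    exact ⟨P * Q, by simp [Polynomial.mul_coeff_zero, hP], map_mul _ _ _⟩
  smul_mem' := by
    rintro c _ ⟨P, hP, rfl⟩
    exact ⟨c • P, by simp [hP], map_smul _ _ _⟩

theorem supportsSupercyclicAlgebra_of_forall_smul_pow_apply_pow_mem
    {T : EntireFunction →L[ℂ] EntireFunction} {f : EntireFunction}
    (hf : ∀ m : ℕ, 1 ≤ m →
      ∀ O : Set (Finset.Icc 1 m → EntireFunction), IsOpen O → ∀ v : EntireFunction,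
        (fun n : Finset.Icc 1 m => if (n : ℕ) = m then v else 0) ∈ O →
          ∃ (c : ℂ) (N : ℕ), (fun n : Finset.Icc 1 m => c • (T ^ N) (f ^ (n : ℕ))) ∈ O) :
    SupportsSupercyclicAlgebra (X := EntireFunction) T := by
  refine ⟨nonUnitalPolynomials f, fun hbot => ?_, ?_⟩
  · have hmem : f ∈ nonUnitalPolynomials f := ⟨Polynomial.X, by simp, by simp⟩
    rw [hbot] at hmem
    have hf0 : f = 0 := NonUnitalAlgebra.mem_bot.1 hmem
    obtain ⟨c, N, h⟩ := hf 1 le_rfl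
      ((fun x : Finset.Icc 1 1 → EntireFunction => x ⟨1, by simp⟩) ⁻¹' {0}ᶜ)
      (isOpen_compl_singleton.preimage
        (continuous_apply (⟨1, by simp⟩ : Finset.Icc 1 1))) 1 (by simp)
    simp [hf0] at h
  · rintro _ ⟨P, hP0, rfl⟩ hx
    have hP : P ≠ 0 := by
      rintro rfl
      exact hx (map_zero _)
    have hlead : P.coeff P.natDegree ≠ 0 := Polynomial.leadingCoeff_ne_zero.2 hP
    have hm : 1 ≤ P.natDegree := by
      by_contra! hcon
      rw [Nat.lt_one_iff.1 hcon] at hlead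
      exact hlead hP0
    set m := P.natDegree
    have haeval : Polynomial.aeval f P = ∑ n : Finset.Icc 1 m, P.coeff n • f ^ (n : ℕ) := by
      rw [Polynomial.aeval_eq_sum_range, Finset.sum_coe_sort (Finset.Icc 1 m)
        fun n => P.coeff n • f ^ n]
      symm
      refine Finset.sum_subset (fun n hn => ?_) fun n hn hn' => ?_
      · rw [Finset.mem_Icc] at hn
        exact Finset.mem_range.2 (Nat.lt_succ_of_le hn.2)
      · have : n = 0 := by
          rw [Finset.mem_range] at hn
          rw [Finset.mem_Icc] at hn'
          omega
        rw [this, hP0, zero_smul]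
    have hcont : Continuous fun x : Finset.Icc 1 m → EntireFunction =>
        ∑ n : Finset.Icc 1 m, P.coeff n • x n := by
      refine continuous_finsetSum _ fun n _ => ?_
      exact (continuous_apply n).const_smul (P.coeff n)
    refine dense_iff_inter_open.2 fun V hV hVne => ?_
    obtain ⟨v, hv⟩ := hVne
    obtain ⟨c, N, h⟩ := hf m hm
      ((fun x : Finset.Icc 1 m → EntireFunction =>
        ∑ n : Finset.Icc 1 m, P.coeff n • x n) ⁻¹' V)
      (hV.preimage hcont) ((P.coeff m)⁻¹ • v) (by
        have hsum : ∑ n : Finset.Icc 1 m, P.coeff n •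
            (if (n : ℕ) = m then (P.coeff m)⁻¹ • v else 0) = v := by
          rw [Finset.sum_coe_sort (Finset.Icc 1 m)
            fun n => P.coeff n • (if n = m then (P.coeff m)⁻¹ • v else 0),
            Finset.sum_eq_single_of_mem m (Finset.mem_Icc.2 ⟨hm, le_rfl⟩)
              fun n _ hn => by rw [if_neg hn, smul_zero], if_pos rfl, smul_smul,
            mul_inv_cancel₀ hlead, one_smul]
        rw [Set.mem_preimage, hsum]
        exact hv)
    refine ⟨_, h, c, N, ?_⟩
    rw [haeval, map_sum, Finset.smul_sum]
    refine Finset.sum_congr rfl fun n _ => ?_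
    rw [map_smul, smul_comm]

theorem theorem1p3 (φ : ℂ → ℂ) (hφ : Differentiable ℂ φ) (hexp : IsExponentialType φ)
    (hnc : ¬ ∃ c : ℂ, ∀ z : ℂ, φ z = c) :
    List.TFAE
      [SupportsSupercyclicAlgebra (X := EntireFunction) (convolutionOperator φ hφ hexp),
       ∃ f : EntireFunction, ∀ m : ℕ, 1 ≤ m →
         IsHypercyclicVector (convolutionOperator φ hφ hexp) (f ^ m),
       ¬ IsMultipleOfExponential φ] := by
  tfae_have 1 → 3 := by
    rintro ⟨A, hA, hsc⟩ h
    obtain ⟨f, hfA, hf0⟩ : ∃ f ∈ A, f ≠ 0 := by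
      by_contra! hcon
      exact hA (eq_bot_iff.2 fun f hf => NonUnitalAlgebra.mem_bot.2 (hcon f hf))
    refine not_isSupercyclicVector_sq_of_isMultipleOfExponential hφ hexp h f (hsc _ ?_ ?_)
    · rw [pow_two]
      exact A.mul_mem hfA hfA
    · refine fun hsq => hf0 (EntireFunction.ext_toFun fun z => ?_)
      have : f.toFun z ^ 2 = 0 := congrArg (fun g => EntireFunction.toFun g z) hsq
      exact pow_eq_zero_iff two_ne_zero |>.1 this
  tfae_have 2 → 3 := by
    rintro ⟨f, hf⟩ h
    refine not_isSupercyclicVector_sq_of_isMultipleOfExponential hφ hexp h f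
      ((hf 2 one_le_two).mono ?_)
    rintro _ ⟨N, rfl⟩
    exact ⟨1, N, (one_smul ℂ _).symm⟩
  tfae_have 3 → 2 := exists_forall_isHypercyclicVector_pow hφ hexp hnc
  tfae_have 3 → 1 := fun hne => by
    obtain ⟨f, hf⟩ := exists_forall_smul_pow_apply_pow_mem hφ hexp hnc hne
    exact supportsSupercyclicAlgebra_of_forall_smul_pow_apply_pow_mem hf
  tfae_finish
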